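/- Let $\mathsf H_1,\dots,\mathsf H_m$ and $\mathsf G_1,\dots,\mathsf G_p$ be separable real Hilbert spaces, with Hilbert direct sums $\mathbf H=\mathsf H_1\oplus\cdots\oplus\mathsf H_m$ and $\mathbf G=\mathsf G_1\oplus\cdots\oplus\mathsf G_p$. For a real Hilbert space $\mathsf E$, let $\Gamma_0(\mathsf E)$ be the class of lower semicontinuous convex functions $\mathsf f\colon\mathsf E\to\left]-\infty,+\infty\right]$ with $\mathsf f\not\equiv+\infty$; for $\mathsf f\in\Gamma_0(\mathsf E)$ let $\partial\mathsf f(\mathsf x)=\{\mathsf u : (\forall \mathsf y)\ \langle \mathsf y-\mathsf x,\mathsf u\rangle+\mathsf f(\mathsf x)\le\mathsf f(\mathsf y)\}$, let $\mathsf f^*(\mathsf u)=\sup_{\mathsf x}(\langle\mathsf x,\mathsf u\rangle-\mathsf f(\mathsf x))$, and let $\operatorname{prox}_{\mathsf f}\mathsf x$ be the unique minimizer of $\mathsf f+\|\mathsf x-\cdot\|^2/2$. For all $1\le i\le m$ and $1\le k\le p$, let $\mathsf f_i\in\Gamma_0(\mathsf H_i)$, let $\mathsf g_k\in\Gamma_0(\mathsf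 G_k)$, and let $\mathsf L_{ki}\colon\mathsf H_i\to\mathsf G_k$ be linear and bounded. Assume that there exist $(\mathsf x_1,\dots,\mathsf x_m)\in\mathbf H$ and $(\mathsf v_1,\dots,\mathsf v_p)\in\mathbf G$ such that $$(\forall k)\quad \mathsf v_k\in\partial\mathsf g_k\Big(\sum_{j=1}^m\mathsf L_{kj}\mathsf x_j\Big)\qquad\text{and}\qquad(\forall i)\quad 0\in\partial\mathsf f_i(\mathsf x_i)+\sum_{k=1}^p\mathsf L_{ki}^*\mathsf v_k .$$ Let $\mathbf F\subset\mathbf H$ be the set of solutions of $$\operatorname*{minimize}_{\mathsf x_1\in\mathsf H_1,\dots,\mathsf x_m\in\mathsf H_m}\ \sum_{i=1}^m\mathsf f_i(\mathsf x_i)+\sum_{k=1}^p\mathsf g_k\Big(\sum_{i=1}^m\mathsf L_{ki}\mathsf x_i\Big)$$ and let $\mathbf F^*\subset\mathbf G$ be the set of solutions of the dual problem $$\operatorname*{minimize}_{\mathsf v_1\in\mathsf G_1,\dots,\mathsf v_p\in\mathsf G_p}\ \sum_{i=1}^m\mathsf f_i^*\Big(-\sum_{k=1}^p\mathsf L_{ki}^*\mathsf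 v_k\Big)+\sum_{k=1}^p\mathsf g_k^*(\mathsf v_k).$$ Let $\gamma\in\left]0,+\infty\right[$ and let $(\mu_n)_{n\in\mathbb N}$ be a sequence in $\left]0,2\right[$ with $\inf_n\mu_n>0$ and $\sup_n\mu_n<2$. On a probability space $(\Omega,\mathcal F,\mathsf P)$, let $x_0,z_0,(a_n)_{n\in\mathbb N},(c_n)_{n\in\mathbb N}$ be $\mathbf H$-valued random variables, let $y_0,w_0,(b_n)_{n\in\mathbb N},(d_n)_{n\in\mathbb N}$ be $\mathbf G$-valued random variables, and let $(\varepsilon_n)_{n\in\mathbb N}$ be identically distributed, pairwise independent random variables with values in $\{0,1\}^{m+p}\smallsetminus\{0\}$. Let $\mathbf P_{\mathbf V}\colon(\mathsf x,\mathsf y)\mapsto(\mathsf Q_j(\mathsf x,\mathsf y))_{1\le j\le m+p}$ be the projection operator of $\mathbf H\oplus\mathbf G$ onto $$\mathbf V=\Big\{(\mathsf x,\mathsf y)\in\mathbf H\oplus\mathbf G : (\forall k)\ \mathsf y_k=\sum_{i=1}^m\mathsf L_{ki}\mathsf x_i\Big\},$$ where $\mathsf Q_i$ ($1\le i\le m$)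 takes values in $\mathsf H_i$ and $\mathsf Q_{m+k}$ ($1\le k\le p$) in $\mathsf G_k$. Iterate, for $n=0,1,\dots$, for all $1\le i\le m$ and $1\le k\le p$, $$\begin{aligned} z_{i,n+1}&=z_{i,n}+\varepsilon_{i,n}\big(\mathsf Q_i(x_n,y_n)+c_{i,n}-z_{i,n}\big),\\ x_{i,n+1}&=x_{i,n}+\varepsilon_{i,n}\mu_n\big(\operatorname{prox}_{\gamma\mathsf f_i}(2z_{i,n+1}-x_{i,n})+a_{i,n}-z_{i,n+1}\big),\\ w_{k,n+1}&=w_{k,n}+\varepsilon_{m+k,n}\big(\mathsf Q_{m+k}(x_n,y_n)+d_{k,n}-w_{k,n}\big),\\ y_{k,n+1}&=y_{k,n}+\varepsilon_{m+k,n}\mu_n\big(\operatorname{prox}_{\gamma\mathsf g_k}(2w_{k,n+1}-y_{k,n})+b_{k,n}-w_{k,n+1}\big). \end{aligned}$$ Set $\mathcal Y_n=\sigma(x_j,y_j)_{0\le j\le n}$ and assume that: 1. almost surely, $\sum_n\sqrt{\mathsf E(\|a_n\|^2\mid\mathcal Y_n)}$, $\sum_n\sqrt{\mathsf E(\|b_n\|^2\mid\mathcal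 Y_n)}$, $\sum_n\sqrt{\mathsf E(\|c_n\|^2\mid\mathcal Y_n)}$ and $\sum_n\sqrt{\mathsf E(\|d_n\|^2\mid\mathcal Y_n)}$ are finite, and $c_n\rightharpoonup 0$ and $d_n\rightharpoonup 0$ weakly; 2. for every $n\in\mathbb N$, $\sigma(\varepsilon_n)$ and $\mathcal Y_n$ are independent; 3. $\mathsf P[\varepsilon_{j,0}=1]>0$ for every $j\in\{1,\dots,m+p\}$. Then $(z_n)_{n\in\mathbb N}$ converges weakly almost surely to an $\mathbf F$-valued random variable, and $(\gamma^{-1}(w_n-y_n))_{n\in\mathbb N}$ converges weakly almost surely to an $\mathbf F^*$-valued random variable. -/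

import Mathlib

open MeasureTheory ProbabilityTheory Filter Topology
open scoped ENNReal InnerProductSpace

namespace BlockPrimalDual

noncomputable section

/-- The class `Γ₀(E)`: lower semicontinuous convex functions `f : E → ]-∞, +∞]` that are not
identically `+∞`. -/
structure GammaZero {E : Type*} [NormedAddCommGroup E] [InnerProductSpace ℝ E]
    (f : E → EReal) : Prop where
  ne_bot : ∀ x, f x ≠ ⊥
  proper : ∃ x, f x ≠ ⊤
  lsc : LowerSemicontinuous f
  convex : ∀ x y : E, ∀ α β : ℝ, 0 < α → 0 < β → α + β = 1 →
    f (α • x + β • y) ≤ (α : EReal) * f x + (β : EReal) * f y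

/-- The Moreau subdifferential of `f` at `x`. -/
def subdiff {E : Type*} [NormedAddCommGroup E] [InnerProductSpace ℝ E]
    (f : E → EReal) (x : E) : Set E :=
  {u | ∀ y : E, ((⟪y - x, u⟫_ℝ : ℝ) : EReal) + f x ≤ f y}

/-- The Fenchel conjugate `f*(u) = sup_x (⟪x, u⟫ - f x)`. -/
def fenchelConj {E : Type*} [NormedAddCommGroup E] [InnerProductSpace ℝ E]
    (f : E → EReal) (u : E) : EReal :=
  ⨆ x : E, (((⟪x, u⟫_ℝ : ℝ) : EReal) - f x)

/-- `prox_f x` is the minimizer of `f + ‖x - ·‖² / 2`; it exists and is unique for `f ∈ Γ₀(E)` and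
`E` complete. -/
def prox {E : Type*} [NormedAddCommGroup E] [InnerProductSpace ℝ E]
    (f : E → EReal) (x : E) : E :=
  Classical.epsilon fun q : E =>
    ∀ y : E, f q + ((‖x - q‖ ^ 2 / 2 : ℝ) : EReal) ≤ f y + ((‖x - y‖ ^ 2 / 2 : ℝ) : EReal)

/-- Weak convergence of a sequence. -/
def WeakTendsto {E : Type*} [NormedAddCommGroup E] [InnerProductSpace ℝ E]
    (u : ℕ → E) (l : E) : Prop :=
  Tendsto (fun n => toWeakSpace ℝ E (u n)) atTop (𝓝 (toWeakSpace ℝ E l))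

section Spaces

variable {m p : ℕ} {H : Fin m → Type*} {G : Fin p → Type*}
  [∀ i, NormedAddCommGroup (H i)] [∀ i, InnerProductSpace ℝ (H i)]
  [∀ k, NormedAddCommGroup (G k)] [∀ k, InnerProductSpace ℝ (G k)]

/-- The subspace `V` of `H ⊕ G` (Hilbert direct sum): `y_k = ∑ i, L_{ki} x_i` for every `k`. -/
def graphSubspace (L : ∀ k i, H i →L[ℝ] G k) :
    Submodule ℝ (WithLp 2 (PiLp 2 H × PiLp 2 G)) where
  carrier := {q | ∀ k, q.snd k = ∑ i, L k i (q.fst i)}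
  zero_mem' := by intro k; simp
  add_mem' := by
    intro a b ha hb k
    simp [ha k, hb k, Finset.sum_add_distrib]
  smul_mem' := by
    intro c a ha k
    simp [ha k, Finset.smul_sum]

theorem isClosed_graphSubspace (L : ∀ k i, H i →L[ℝ] G k) :
    IsClosed (graphSubspace L : Set (WithLp 2 (PiLp 2 H × PiLp 2 G))) := by
  have h : (graphSubspace L : Set (WithLp 2 (PiLp 2 H × PiLp 2 G))) =
      ⋂ k, {q | q.snd k = ∑ i, L k i (q.fst i)} := by
    ext q
    simp only [Set.mem_iInter, Set.mem_ofPred_eq]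
    exact Iff.rfl
  rw [h]
  refine isClosed_iInter fun k => isClosed_eq ?_ ?_
  · fun_prop
  · fun_prop

instance instHasOrthogonalProjectionGraphSubspace [∀ i, CompleteSpace (H i)]
    [∀ k, CompleteSpace (G k)] (L : ∀ k i, H i →L[ℝ] G k) :
    (graphSubspace L).HasOrthogonalProjection := by
  have : CompleteSpace (graphSubspace L) := (isClosed_graphSubspace L).completeSpace_coe
  infer_instance

/-- The projection operator `P_V` of `H ⊕ G` onto `V`; its first `m` components are
`(projV L x y).fst i` and its last `p` components are `(projV L x y).snd k`. -/
def projV [∀ i, CompleteSpace (H i)] [∀ k, CompleteSpace (G k)] (L : ∀ k i, H i →L[ℝ] G k)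
    (x : PiLp 2 H) (y : PiLp 2 G) : WithLp 2 (PiLp 2 H × PiLp 2 G) :=
  (graphSubspace L).starProjection (WithLp.toLp 2 (x, y))

/-- The primal objective. -/
def primalObjective (f : ∀ i, H i → EReal) (g : ∀ k, G k → EReal) (L : ∀ k i, H i →L[ℝ] G k)
    (x : PiLp 2 H) : EReal :=
  ∑ i, f i (x i) + ∑ k, g k (∑ i, L k i (x i))

/-- The dual objective. -/
def dualObjective [∀ i, CompleteSpace (H i)] [∀ k, CompleteSpace (G k)]
    (f : ∀ i, H i → EReal) (g : ∀ k, G k → EReal) (L : ∀ k i, H i →L[ℝ] G k)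
    (v : PiLp 2 G) : EReal :=
  ∑ i, fenchelConj (f i) (-∑ k, ContinuousLinearMap.adjoint (L k i) (v k)) + ∑ k, fenchelConj (g k) (v k)

/-- The solution set `F` of the primal problem. -/
def primalSolutions (f : ∀ i, H i → EReal) (g : ∀ k, G k → EReal) (L : ∀ k i, H i →L[ℝ] G k) :
    Set (PiLp 2 H) :=
  {x | ∀ x', primalObjective f g L x ≤ primalObjective f g L x'}

/-- The solution set `F*` of the dual problem. -/
def dualSolutions [∀ i, CompleteSpace (H i)] [∀ k, CompleteSpace (G k)]
    (f : ∀ i, H i → EReal) (g : ∀ k, G k → EReal) (L : ∀ k i, H i →L[ℝ] G k) :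
    Set (PiLp 2 G) :=
  {v | ∀ v', dualObjective f g L v ≤ dualObjective f g L v'}

end Spaces

/-- The set `D = {0,1}^{m+p} ∖ {0}`, the coordinates being indexed by `Fin m ⊕ Fin p`. -/
abbrev Activation (m p : ℕ) : Type :=
  {e : Fin m ⊕ Fin p → Fin 2 // e ≠ 0}

/-- The `j`-th coordinate of an element of `D`, as a real number. -/
def coeff {m p : ℕ} (e : Activation m p) (j : Fin m ⊕ Fin p) : ℝ :=
  ((e.1 j : ℕ) : ℝ)

/-- The σ-algebra `σ(x_j, y_j : 0 ≤ j ≤ n)`. -/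
@[reducible] def pastSigma {Ω A B : Type*} [MeasurableSpace A] [MeasurableSpace B]
    (x : ℕ → Ω → A) (y : ℕ → Ω → B) (n : ℕ) : MeasurableSpace Ω :=
  ⨆ j ∈ Set.Iic n, MeasurableSpace.comap (fun ω => (x j ω, y j ω)) inferInstance

/-- `∑_n √(E[‖a_n‖² | 𝓕_n]) < +∞` almost surely, where `E[· | 𝓕_n]` is the conditional
expectation of nonnegative random variables (no integrability is required). -/
def SummableErrors {Ω E : Type*} [MeasurableSpace Ω] [NormedAddCommGroup E]
    (P : Measure Ω) (𝓕 : ℕ → MeasurableSpace Ω) (a : ℕ → Ω → E) : Prop :=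
  ∀ᵐ ω ∂P, ∑' n, ((condLExp (𝓕 n) P (fun ω' => ‖a n ω'‖ₑ ^ 2)) ω) ^ (1 / 2 : ℝ) < ∞

end

end BlockPrimalDual

/-! Write s = (x, y) in H ⊕ G, and let N (`reflectedOperator`) be the reflection through V followed
by the blockwise reflected proximity operators of γ f_i and γ g_k. Each factor is nonexpansive,
hence so is N. On an active block the algorithm performs s + (μ_n/2)(N s - s) up to an error, so s_n
is a randomly activated Krasnosel'skii–Mann iteration. If N s = s and q = P_V s, then blockwise q -
s is γ times a subgradient at q, and q - s is orthogonal to V. As V^⊥ consists of the pairs (-L^* v,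
v), this is the Karush–Kuhn–Tucker system: q carries a primal solution and γ⁻¹(q - s) a dual one
(`mem_solutions_of_fixed`).

For the convergence of s_n, block j is weighted by the inverse of its activation probability.
Averaging over the activation then turns the change of the weighted squared distance to a fixed
point into the change of the ordinary squared distance under a full relaxed step, which is at most
-l(1 - l)‖N s - s‖² with l = μ_n/2. Errors enter through Young's inequality, and
`lintegral_weighted_dist_le` is the resulting almost supermartingale inequality. The
Robbins–Siegmund theorem (`ae_tendsto_of_almost_supermartingale`) yields convergence of the weighted
distances and summability of the squared residuals. Demiclosedness and Opial's argument
(`exists_weak_limit_fixed`) then give a weak limit t fixed by N. Conditional inequalities are tested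
against nonnegative weights in [0, ∞], so the initial points need no moments.

Finally, each block of z_n and w_n is a held value of the corresponding block of P_V s_k plus an
error, refreshed at every activation. The strong law makes activations recur for each block, so z_n
and w_n converge weakly to the components of P_V t, and w_n - y_n follows. -/

namespace BlockPrimalDual

/-! ### Weak limits in Hilbert spaces: demiclosedness, Opial's lemma, measurability. -/

section Weak

variable {E : Type*} [NormedAddCommGroup E] [InnerProductSpace ℝ E]

theorem weakTendsto_iff_inner [CompleteSpace E] {u : ℕ → E} {l : E} :
    WeakTendsto u l ↔ ∀ v : E, Tendsto (fun n => ⟪v, u n⟫_ℝ) atTop (𝓝 ⟪v, l⟫_ℝ) := by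
  have hinj : Function.Injective (topDualPairing ℝ E).flip := by
    intro a b hab
    refine ext_inner_left ℝ fun v => ?_
    exact LinearMap.congr_fun hab (InnerProductSpace.toDual ℝ E v)
  have h := WeakBilin.tendsto_iff_forall_eval_tendsto (l := atTop) _
    (f := fun n => toWeakSpace ℝ E (u n)) (x := toWeakSpace ℝ E l) hinj
  refine h.trans ⟨fun H v => H (InnerProductSpace.toDual ℝ E v), fun H φ => ?_⟩
  have hv := H ((InnerProductSpace.toDual ℝ E).symm φ)
  simp only [InnerProductSpace.toDual_symm_apply] at hv
  exact hv

/-- Banach–Alaoglu in the dual, carried back by the Riesz isomorphism. Working along ultrafilters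
avoids extracting subsequences. -/
theorem exists_weak_limit_of_bounded [CompleteSpace E] {ι : Type*} (U : Ultrafilter ι) (u : ι → E)
    (M : ℝ) (hM : ∀ n, ‖u n‖ ≤ M) :
    ∃ x : E, ∀ v : E, Tendsto (fun n => ⟪v, u n⟫_ℝ) U (𝓝 ⟪v, x⟫_ℝ) := by
  let D : ι → WeakDual ℝ E := fun n => StrongDual.toWeakDual (InnerProductSpace.toDual ℝ E (u n))
  obtain ⟨φ, -, hφ⟩ := (WeakDual.isCompact_closedBall (𝕜 := ℝ) (E := E) 0 M).ultrafilter_le_nhds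
    (U.map D) (by
      rw [le_principal_iff]
      change ∀ᶠ n in (U : Filter ι), D n ∈ _
      refine Filter.Eventually.of_forall fun n => ?_
      simpa [D] using hM n)
  refine ⟨(InnerProductSpace.toDual ℝ E).symm (WeakDual.toStrongDual φ), fun v => ?_⟩
  have h : Tendsto D U (𝓝 φ) := hφ
  have h2 := (tendsto_iff_forall_eval_tendsto_topDualPairing.1 h) v
  have e1 : ⟪v, (InnerProductSpace.toDual ℝ E).symm (WeakDual.toStrongDual φ)⟫_ℝ = φ v := by
    rw [real_inner_comm, InnerProductSpace.toDual_symm_apply]; rfl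
  rw [e1]
  refine h2.congr fun n => ?_
  change ⟪u n, v⟫_ℝ = _
  exact real_inner_comm _ _

/-- Demiclosedness principle for a nonexpansive operator. -/
theorem fixed_of_weak_limit {ι : Type*} {l : Filter ι} [l.NeBot] {N : E → E}
    (hN : ∀ s t, ‖N s - N t‖ ≤ ‖s - t‖) {u : ι → E} {x : E} {M : ℝ} (hM : ∀ n, ‖u n‖ ≤ M)
    (hu : ∀ v : E, Tendsto (fun n => ⟪v, u n⟫_ℝ) l (𝓝 ⟪v, x⟫_ℝ))
    (hr : Tendsto (fun n => ‖N (u n) - u n‖) l (𝓝 0)) : N x = x := by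
  -- Expand ‖u n - N x‖² around x and bound the same norm by ‖N (u n) - u n‖ + ‖u n - x‖. The terms
  -- ‖u n - x‖² cancel, and everything left on the right tends to 0.
  have key : ∀ n, ‖x - N x‖ ^ 2 ≤ 2 * (M + ‖x‖) * ‖N (u n) - u n‖ + ‖N (u n) - u n‖ ^ 2
      - 2 * (⟪x - N x, u n⟫_ℝ - ⟪x - N x, x⟫_ℝ) := by
    intro n
    have h1 : ‖u n - N x‖ ≤ ‖N (u n) - u n‖ + ‖u n - x‖ := by
      calc ‖u n - N x‖ = ‖-(N (u n) - u n) + (N (u n) - N x)‖ := by congr 1; abel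
        _ ≤ ‖N (u n) - u n‖ + ‖N (u n) - N x‖ := by
          refine (norm_add_le _ _).trans ?_
          rw [norm_neg]
        _ ≤ _ := by gcongr; exact hN _ _
    have h2 : ‖u n - N x‖ ^ 2 = ‖u n - x‖ ^ 2 + 2 * ⟪u n - x, x - N x⟫_ℝ + ‖x - N x‖ ^ 2 := by
      rw [← norm_add_sq_real]; congr 2; abel
    have h3 : ⟪u n - x, x - N x⟫_ℝ = ⟪x - N x, u n⟫_ℝ - ⟪x - N x, x⟫_ℝ := by
      rw [real_inner_comm, inner_sub_right]
    have h4 : ‖u n - x‖ ≤ M + ‖x‖ := (norm_sub_le _ _).trans (by gcongr; exact hM n)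
    have h5 : ‖u n - N x‖ ^ 2 ≤ (‖N (u n) - u n‖ + ‖u n - x‖) ^ 2 := by gcongr
    have h6 := mul_le_mul_of_nonneg_left h4 (norm_nonneg (N (u n) - u n))
    nlinarith
  have lim : Tendsto (fun n => 2 * (M + ‖x‖) * ‖N (u n) - u n‖ + ‖N (u n) - u n‖ ^ 2
      - 2 * (⟪x - N x, u n⟫_ℝ - ⟪x - N x, x⟫_ℝ)) l (𝓝 (2 * (M + ‖x‖) * 0 + 0 ^ 2
      - 2 * (⟪x - N x, x⟫_ℝ - ⟪x - N x, x⟫_ℝ))) :=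
    ((hr.const_mul _).add (hr.pow 2)).sub (((hu _).sub_const _).const_mul 2)
  have h := ge_of_tendsto' lim key
  have h0 : ‖x - N x‖ ^ 2 ≤ 0 := by simpa using h
  have : ‖x - N x‖ = 0 := by nlinarith [norm_nonneg (x - N x)]
  exact (sub_eq_zero.1 (norm_eq_zero.1 this)).symm

/-- Opial's lemma for a nonexpansive operator and a block-weighted norm. -/
theorem exists_weak_limit_fixed [CompleteSpace E] {J : Type*} [Fintype J] {Q : J → E →L[ℝ] E}
    (hQ : ∀ s, ∑ j, ‖Q j s‖ ^ 2 = ‖s‖ ^ 2) {c : J → ℝ} (hc : ∀ j, 0 < c j) {N : E → E}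
    (hN : ∀ s t, ‖N s - N t‖ ≤ ‖s - t‖) (hfix : ∃ x, N x = x) {u : ℕ → E}
    (hu : ∀ x, N x = x → ∃ l, Tendsto (fun n => ∑ j, c j * ‖Q j (u n - x)‖ ^ 2) atTop (𝓝 l))
    (hr : Tendsto (fun n => ‖N (u n) - u n‖) atTop (𝓝 0)) :
    ∃ x, N x = x ∧ ∀ v : E, Tendsto (fun n => ⟪v, u n⟫_ℝ) atTop (𝓝 ⟪v, x⟫_ℝ) := by
  obtain ⟨x₀, hx₀⟩ := hfix
  have zero_of : ∀ s : E, ∑ j, c j * ‖Q j s‖ ^ 2 = 0 → s = 0 := by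
    intro s hs
    have h1 := (Finset.sum_eq_zero_iff_of_nonneg
      (fun j _ => mul_nonneg (hc j).le (sq_nonneg ‖Q j s‖))).1 hs
    have h2 : ‖s‖ ^ 2 = 0 := by
      rw [← hQ]
      refine Finset.sum_eq_zero fun j hj => ?_
      exact (mul_eq_zero.1 (h1 j hj)).resolve_left (hc j).ne'
    simpa using h2
  obtain ⟨M, hM⟩ : ∃ M, ∀ n, ‖u n‖ ≤ M := by
    obtain ⟨l, hl⟩ := hu x₀ hx₀
    obtain ⟨B, hB⟩ := hl.bddAbove_range
    let C := ∑ j, (c j)⁻¹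
    refine ⟨(C * B + 1) + ‖x₀‖, fun n => ?_⟩
    have hBn : ∑ j, c j * ‖Q j (u n - x₀)‖ ^ 2 ≤ B := hB ⟨n, rfl⟩
    have h1 : ‖u n - x₀‖ ^ 2 ≤ C * B := by
      rw [← hQ, Finset.sum_mul]
      refine Finset.sum_le_sum fun j _ => ?_
      have h2 : c j * ‖Q j (u n - x₀)‖ ^ 2 ≤ B := le_trans
        (Finset.single_le_sum (f := fun j => c j * ‖Q j (u n - x₀)‖ ^ 2)
          (fun j _ => mul_nonneg (hc j).le (sq_nonneg _)) (Finset.mem_univ j)) hBn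
      rw [inv_mul_eq_div, le_div_iff₀ (hc j)]; linarith
    have h3 : ‖u n - x₀‖ ≤ C * B + 1 := by nlinarith [sq_nonneg (‖u n - x₀‖ - 1)]
    calc ‖u n‖ = ‖(u n - x₀) + x₀‖ := by rw [sub_add_cancel]
      _ ≤ _ := (norm_add_le _ _).trans (by gcongr)
  have lim_fix : ∀ (U : Ultrafilter ℕ), (U : Filter ℕ) ≤ atTop → ∃ x, N x = x ∧
      ∀ v : E, Tendsto (fun n => ⟪v, u n⟫_ℝ) U (𝓝 ⟪v, x⟫_ℝ) := by
    intro U hU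
    obtain ⟨x, hx⟩ := exists_weak_limit_of_bounded U u M hM
    exact ⟨x, fixed_of_weak_limit hN hM hx (hr.mono_left hU), hx⟩
  have unique : ∀ (U U' : Ultrafilter ℕ), (U : Filter ℕ) ≤ atTop → (U' : Filter ℕ) ≤ atTop →
      ∀ x x', N x = x → N x' = x' → (∀ v : E, Tendsto (fun n => ⟪v, u n⟫_ℝ) U (𝓝 ⟪v, x⟫_ℝ)) →
      (∀ v : E, Tendsto (fun n => ⟪v, u n⟫_ℝ) U' (𝓝 ⟪v, x'⟫_ℝ)) → x = x' := by
    intro U U' hU hU' x x' hx hx' hlim hlim'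
    obtain ⟨l, hl⟩ := hu x hx
    obtain ⟨l', hl'⟩ := hu x' hx'
    have h := hl'.sub hl
    let z : E := ∑ j, (2 * c j) • (Q j).adjoint (Q j (x - x'))
    let k : ℝ := ∑ j, c j * (‖Q j x'‖ ^ 2 - ‖Q j x‖ ^ 2)
    have e : ∀ n, ∑ j, c j * ‖Q j (u n - x')‖ ^ 2 - ∑ j, c j * ‖Q j (u n - x)‖ ^ 2 =
        ⟪z, u n⟫_ℝ + k := by
      intro n
      simp only [z, k, sum_inner, ← Finset.sum_sub_distrib, ← Finset.sum_add_distrib]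
      refine Finset.sum_congr rfl fun j _ => ?_
      rw [map_sub, map_sub, norm_sub_sq_real, norm_sub_sq_real, inner_smul_left,
        ContinuousLinearMap.adjoint_inner_left, map_sub, inner_sub_left,
        real_inner_comm (Q j x), real_inner_comm (Q j x')]
      simp only [conj_trivial]
      ring
    simp only [e] at h
    have h2 := tendsto_nhds_unique (h.mono_left hU) ((hlim z).add_const k)
    have h3 := tendsto_nhds_unique (h.mono_left hU') ((hlim' z).add_const k)
    have h4 : ⟪z, x - x'⟫_ℝ = 0 := by rw [inner_sub_right]; linarith
    have h5 : ⟪z, x - x'⟫_ℝ = 2 * ∑ j, c j * ‖Q j (x - x')‖ ^ 2 := by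
      simp only [z, sum_inner, Finset.mul_sum]
      refine Finset.sum_congr rfl fun j _ => ?_
      rw [inner_smul_left, ContinuousLinearMap.adjoint_inner_left, real_inner_self_eq_norm_sq]
      simp only [conj_trivial]
      ring
    exact sub_eq_zero.1 (zero_of _ (by linarith))
  obtain ⟨x, hx, hlim⟩ := lim_fix (hyperfilter ℕ) Nat.hyperfilter_le_atTop
  refine ⟨x, hx, fun v => (tendsto_iff_ultrafilter _ _ _).2 fun U hU => ?_⟩
  obtain ⟨x', hx', hlim'⟩ := lim_fix U hU
  rw [unique _ U Nat.hyperfilter_le_atTop hU x x' hx hx' hlim hlim']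
  exact hlim' v

/-- Inner products with a dense sequence embed E continuously and injectively into ℝ^ℕ. As E is
Polish, Lusin–Souslin makes this a measurable embedding, so measurability can be tested
coordinatewise. -/
theorem measurable_of_inner [CompleteSpace E] [TopologicalSpace.SeparableSpace E]
    [MeasurableSpace E] [BorelSpace E] {Ω : Type*} [MeasurableSpace Ω] {f : Ω → E}
    (hf : ∀ v : E, Measurable fun ω => ⟪v, f ω⟫_ℝ) : Measurable f := by
  let ψ : E → ℕ → ℝ := fun x k => ⟪TopologicalSpace.denseSeq E k, x⟫_ℝ
  have hψ : Continuous ψ := by fun_prop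
  have hinj : Function.Injective ψ := by
    intro a b hab
    refine ext_inner_left ℝ fun v => ?_
    have hcl : IsClosed {v : E | ⟪v, a⟫_ℝ = ⟪v, b⟫_ℝ} :=
      isClosed_eq (by fun_prop) (by fun_prop)
    have hsub : Set.range (TopologicalSpace.denseSeq E) ⊆ {v : E | ⟪v, a⟫_ℝ = ⟪v, b⟫_ℝ} := by
      rintro _ ⟨k, rfl⟩
      exact congrFun hab k
    exact closure_minimal hsub hcl (TopologicalSpace.denseRange_denseSeq E v)
  rw [← (hψ.measurableEmbedding hinj).measurable_comp_iff]
  exact measurable_pi_iff.2 fun k => hf _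

/-- An almost sure weak limit can be replaced by a measurable one. -/
theorem exists_measurable_weak_limit [CompleteSpace E] [TopologicalSpace.SeparableSpace E]
    [MeasurableSpace E] [BorelSpace E] {Ω : Type*} [MeasurableSpace Ω] {P : Measure Ω}
    {u : ℕ → Ω → E} (hu : ∀ n, Measurable (u n)) {S : Set E} (hS : S.Nonempty)
    (h : ∀ᵐ ω ∂P, ∃ x ∈ S, WeakTendsto (fun n => u n ω) x) :
    ∃ l : Ω → E, Measurable l ∧ (∀ ω, l ω ∈ S) ∧ ∀ᵐ ω ∂P, WeakTendsto (fun n => u n ω) (l ω) := by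
  classical
  obtain ⟨x₀, hx₀⟩ := hS
  obtain ⟨A, hAsub, hA, hPA⟩ := exists_measurable_superset_of_null h
  have hA' : ∀ ω, ω ∉ A → ∃ x ∈ S, WeakTendsto (fun n => u n ω) x := by
    intro ω hω
    by_contra hcon
    exact hω (hAsub hcon)
  choose! l hlS hl using hA'
  -- Off the measurable null set `A` the inner products of `l` are pointwise limits of measurable
  -- functions. On `A` the constant x₀ keeps the values in `S` for every ω.
  refine ⟨A.piecewise (fun _ => x₀) l, ?_, ?_, ?_⟩
  · refine measurable_of_inner fun v => ?_
    refine measurable_of_tendsto_metrizable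
      (f := fun n ω => ⟪v, A.piecewise (fun _ => x₀) (u n) ω⟫_ℝ) (fun n => ?_) ?_
    · exact (by fun_prop : Measurable fun x : E => ⟪v, x⟫_ℝ).comp
        (Measurable.piecewise hA measurable_const (hu n))
    · refine tendsto_pi_nhds.2 fun ω => ?_
      by_cases hω : ω ∈ A
      · simp [hω]
      · simpa [hω] using weakTendsto_iff_inner.1 (hl ω hω) v
  · intro ω
    by_cases hω : ω ∈ A
    · simpa [hω] using hx₀
    · simpa [hω] using hlS ω hω
  · have : ∀ᵐ ω ∂P, ω ∉ A := measure_eq_zero_iff_ae_notMem.1 hPA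
    filter_upwards [this] with ω hω
    simpa [hω] using hl ω hω

end Weak

/-! ### Almost supermartingales and the Robbins–Siegmund theorem. -/

section RobbinsSiegmund

variable {Ω : Type*} {mΩ : MeasurableSpace Ω} {P : Measure Ω} [IsProbabilityMeasure P]
  {𝓕 : Filtration ℕ mΩ}

/-- Convergence of almost supermartingales with uniformly summable additive perturbations. -/
theorem ae_tendsto_of_almost_supermartingale_of_bdd {U b t : ℕ → Ω → ℝ≥0∞} {k : ℝ≥0∞}
    (hk : k ≠ ∞) (hU : ∀ n, Measurable[𝓕 n] (U n)) (hb : ∀ n, Measurable[𝓕 n] (b n))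
    (ht : ∀ n, Measurable (t n)) (hU0 : ∫⁻ ω, U 0 ω ∂P ≠ ∞) (hbk : ∀ ω, ∑' n, b n ω ≤ k)
    (h : ∀ n S, MeasurableSet[𝓕 n] S →
      ∫⁻ ω in S, (U (n + 1) ω + t n ω) ∂P ≤ ∫⁻ ω in S, (U n ω + b n ω) ∂P) :
    ∀ᵐ ω ∂P, (∃ c : ℝ, Tendsto (fun n => (U n ω).toReal) atTop (𝓝 c)) ∧ ∑' n, t n ω < ∞ := by
  have hU' : ∀ n, Measurable (U n) := fun n => (hU n).mono (𝓕.le n) le_rfl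
  have hb' : ∀ n, Measurable (b n) := fun n => (hb n).mono (𝓕.le n) le_rfl
  -- Telescoping the inequality over the whole space bounds every expectation of `U n` and the total
  -- expectation of the `t n`.
  have htot : ∀ n, ∫⁻ ω, U n ω ∂P + ∑ j ∈ Finset.range n, ∫⁻ ω, t j ω ∂P ≤
      ∫⁻ ω, U 0 ω ∂P + ∑ j ∈ Finset.range n, ∫⁻ ω, b j ω ∂P := by
    intro n
    induction n with
    | zero => simp
    | succ n ih =>
      have h1 := h n Set.univ MeasurableSet.univ
      simp only [Measure.restrict_univ] at h1
      rw [lintegral_add_left (hU' _), lintegral_add_left (hU' _)] at h1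
      rw [Finset.sum_range_succ, Finset.sum_range_succ]
      calc _ = (∫⁻ ω, U (n + 1) ω ∂P + ∫⁻ ω, t n ω ∂P) +
            ∑ j ∈ Finset.range n, ∫⁻ ω, t j ω ∂P := by ring
        _ ≤ (∫⁻ ω, U n ω ∂P + ∫⁻ ω, b n ω ∂P) + ∑ j ∈ Finset.range n, ∫⁻ ω, t j ω ∂P := by gcongr
        _ = (∫⁻ ω, U n ω ∂P + ∑ j ∈ Finset.range n, ∫⁻ ω, t j ω ∂P) + ∫⁻ ω, b n ω ∂P := by ring
        _ ≤ _ := by rw [← add_assoc]; gcongr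
  have hbsum : ∀ n, ∑ j ∈ Finset.range n, ∫⁻ ω, b j ω ∂P ≤ k := by
    intro n
    rw [← lintegral_finsetSum _ (fun j _ => hb' j)]
    calc _ ≤ ∫⁻ _, k ∂P := lintegral_mono fun ω => (ENNReal.sum_le_tsum _).trans (hbk ω)
      _ = k := by simp
  set B : ℝ≥0∞ := ∫⁻ ω, U 0 ω ∂P + k with hB
  have hBtop : B ≠ ∞ := ENNReal.add_ne_top.2 ⟨hU0, hk⟩
  have hUB : ∀ n, ∫⁻ ω, U n ω ∂P ≤ B := fun n =>
    le_self_add.trans ((htot n).trans (by rw [hB]; gcongr; exact hbsum n))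
  have htB : ∑' n, ∫⁻ ω, t n ω ∂P ≤ B := by
    refine ENNReal.tsum_le_of_sum_range_le fun n => ?_
    exact le_add_self.trans ((htot n).trans (by rw [hB]; gcongr; exact hbsum n))
  have htfin : ∀ᵐ ω ∂P, ∑' n, t n ω < ∞ := by
    refine ae_lt_top (Measurable.tsum ht) ?_
    rw [lintegral_tsum fun n => (ht n).aemeasurable]
    exact ne_top_of_le_ne_top hBtop htB
  have hUtop : ∀ n, ∫⁻ ω, U n ω ∂P ≠ ∞ := fun n => ne_top_of_le_ne_top hBtop (hUB n)
  have hble : ∀ n ω, b n ω ≤ k := fun n ω => (ENNReal.le_tsum n).trans (hbk ω)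
  have hbtop : ∀ n, ∫⁻ ω, b n ω ∂P ≠ ∞ := fun n => ne_top_of_le_ne_top hk <| by
    calc _ ≤ ∫⁻ _, k ∂P := lintegral_mono fun ω => hble n ω
      _ = k := by simp
  have hUint : ∀ n, Integrable (fun ω => (U n ω).toReal) P := fun n =>
    integrable_toReal_of_lintegral_ne_top (hU' n).aemeasurable (hUtop n)
  have hbint : ∀ n, Integrable (fun ω => (b n ω).toReal) P := fun n =>
    integrable_toReal_of_lintegral_ne_top (hb' n).aemeasurable (hbtop n)
  have setInt : ∀ (S : Set Ω) (F : Ω → ℝ≥0∞), Measurable F → ∫⁻ ω, F ω ∂P ≠ ∞ →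
      ∫ ω in S, (F ω).toReal ∂P = (∫⁻ ω in S, F ω ∂P).toReal := by
    intro S F hF hFt
    exact integral_toReal hF.aemeasurable
      (ae_restrict_of_ae (ae_lt_top hF hFt))
  -- Compensating by the accumulated perturbations makes -U a submartingale, bounded in L¹, so
  -- Doob's convergence theorem applies.
  let f : ℕ → Ω → ℝ := fun n ω => ∑ j ∈ Finset.range n, (b j ω).toReal - (U n ω).toReal
  have hsub : Submartingale f 𝓕 P := by
    refine submartingale_of_setIntegral_le_succ (fun n => ?_) (fun n => ?_) fun n S hS => ?_
    · refine Measurable.stronglyMeasurable ?_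
      refine Measurable.sub (Finset.measurable_fun_sum _ fun j hj => ?_) (hU n).ennreal_toReal
      exact ((hb j).mono (𝓕.mono (Finset.mem_range.1 hj).le) le_rfl).ennreal_toReal
    · exact (integrable_finsetSum _ fun j _ => hbint j).sub (hUint n)
    · have hsumint : ∀ n, Integrable (fun ω => ∑ j ∈ Finset.range n, (b j ω).toReal) P := fun n =>
        integrable_finsetSum _ fun j _ => hbint j
      have e1 : ∫ ω in S, f n ω ∂P = ∫ ω in S, ∑ j ∈ Finset.range n, (b j ω).toReal ∂P -
          ∫ ω in S, (U n ω).toReal ∂P :=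
        integral_sub (hsumint n).integrableOn (hUint n).integrableOn
      have e2 : ∫ ω in S, f (n + 1) ω ∂P = ∫ ω in S, ∑ j ∈ Finset.range n, (b j ω).toReal ∂P +
          ∫ ω in S, (b n ω).toReal ∂P - ∫ ω in S, (U (n + 1) ω).toReal ∂P := by
        rw [← integral_add (hsumint n).integrableOn (hbint n).integrableOn]
        simp only [← Finset.sum_range_succ]
        exact integral_sub (hsumint (n + 1)).integrableOn (hUint (n + 1)).integrableOn
      rw [e1, e2, setInt S _ (hU' n) (hUtop n), setInt S _ (hU' _) (hUtop _),
        setInt S _ (hb' n) (hbtop n)]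
      have h1 := h n S hS
      rw [lintegral_add_left (hU' _), lintegral_add_left (hU' _)] at h1
      have fin : ∀ F : Ω → ℝ≥0∞, ∫⁻ ω, F ω ∂P ≠ ∞ → ∫⁻ ω in S, F ω ∂P ≠ ∞ := fun F hF =>
        ne_top_of_le_ne_top hF (setLIntegral_le_lintegral _ _)
      have h2 := ENNReal.toReal_mono (ENNReal.add_ne_top.2 ⟨fin _ (hUtop n), fin _ (hbtop n)⟩)
        (le_self_add.trans h1)
      rw [ENNReal.toReal_add (fin _ (hUtop n)) (fin _ (hbtop n))] at h2
      linarith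
  have hbdd : ∀ n, eLpNorm (f n) 1 P ≤ (k + B).toNNReal := by
    intro n
    rw [ENNReal.coe_toNNReal (ENNReal.add_ne_top.2 ⟨hk, hBtop⟩), eLpNorm_one_eq_lintegral_enorm]
    calc ∫⁻ ω, ‖f n ω‖ₑ ∂P ≤ ∫⁻ ω, (k + U n ω) ∂P := by
          refine lintegral_mono fun ω => ?_
          refine enorm_sub_le.trans (add_le_add ?_ ?_)
          · calc ‖∑ j ∈ Finset.range n, (b j ω).toReal‖ₑ
                ≤ ∑ j ∈ Finset.range n, ‖(b j ω).toReal‖ₑ := enorm_sum_le _ _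
              _ ≤ ∑ j ∈ Finset.range n, b j ω := by
                refine Finset.sum_le_sum fun j _ => ?_
                rw [Real.enorm_of_nonneg ENNReal.toReal_nonneg]
                exact ENNReal.ofReal_toReal_le
              _ ≤ k := (ENNReal.sum_le_tsum _).trans (hbk ω)
          · rw [Real.enorm_of_nonneg ENNReal.toReal_nonneg]
            exact ENNReal.ofReal_toReal_le
      _ = k + ∫⁻ ω, U n ω ∂P := by rw [lintegral_add_left measurable_const]; simp
      _ ≤ k + B := by gcongr; exact hUB n
  filter_upwards [hsub.exists_ae_tendsto_of_bdd hbdd, htfin] with ω ⟨c, hc⟩ htω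
  refine ⟨?_, htω⟩
  have hs : Summable fun n => (b n ω).toReal :=
    ENNReal.summable_toReal (ne_top_of_le_ne_top hk (hbk ω))
  refine ⟨_, (hs.hasSum.tendsto_sum_nat.sub hc).congr fun n => ?_⟩
  simp [f]

/-- The Robbins–Siegmund theorem, with the conditional inequality tested against nonnegative
weights so that no integrability is required. -/
theorem ae_tendsto_of_almost_supermartingale {V θ α β : ℕ → Ω → ℝ≥0∞}
    (hV : ∀ n, Measurable[𝓕 n] (V n)) (hθ : ∀ n, Measurable (θ n))
    (hα : ∀ n, Measurable[𝓕 n] (α n)) (hβ : ∀ n, Measurable[𝓕 n] (β n))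
    (hVtop : ∀ n ω, V n ω ≠ ∞) (hαs : ∀ᵐ ω ∂P, ∑' n, α n ω < ∞) (hβs : ∀ᵐ ω ∂P, ∑' n, β n ω < ∞)
    (h : ∀ n (η : Ω → ℝ≥0∞), Measurable[𝓕 n] η →
      ∫⁻ ω, η ω * (V (n + 1) ω + θ n ω) ∂P ≤
        ∫⁻ ω, η ω * ((1 + α n ω) * V n ω + β n ω) ∂P) :
    ∀ᵐ ω ∂P, (∃ c : ℝ, Tendsto (fun n => (V n ω).toReal) atTop (𝓝 c)) ∧ ∑' n, θ n ω < ∞ := by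
  -- Dividing by `G` removes the factors 1 + α. The events `A k n` truncate: there the initial value
  -- and the perturbations up to and including index n are at most k, and since α n and β n are
  -- known at time n, `A k n` belongs to 𝓕 n.
  let G : ℕ → Ω → ℝ≥0∞ := fun n ω => ∏ j ∈ Finset.range n, (1 + α j ω)
  let s : ℕ → Ω → ℝ≥0∞ := fun n ω => ∑ j ∈ Finset.range (n + 1), (α j ω + β j ω)
  let A : ℕ → ℕ → Set Ω := fun k n => {ω | V 0 ω ≤ k} ∩ {ω | s n ω ≤ k}
  have hG1 : ∀ n ω, 1 ≤ G n ω := fun n ω => Finset.one_le_prod' fun j _ => le_self_add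
  have hGm : ∀ n, Measurable[𝓕 n] (G (n + 1)) := fun n => Finset.measurable_fun_prod _ fun j hj =>
    ((hα j).mono (𝓕.mono (Nat.lt_succ_iff.1 (Finset.mem_range.1 hj))) le_rfl).const_add 1
  have hGm' : ∀ n, Measurable[𝓕 n] (G n) := fun n => Finset.measurable_fun_prod _ fun j hj =>
    ((hα j).mono (𝓕.mono (Finset.mem_range.1 hj).le) le_rfl).const_add 1
  have hsm : ∀ n, Measurable[𝓕 n] (s n) := fun n => Finset.measurable_fun_sum _ fun j hj =>
    ((hα j).add (hβ j)).mono (𝓕.mono (Nat.lt_succ_iff.1 (Finset.mem_range.1 hj))) le_rfl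
  have hA : ∀ k n, MeasurableSet[𝓕 n] (A k n) := fun k n =>
    ((measurableSet_le ((hV 0).mono (𝓕.mono (Nat.zero_le n)) le_rfl) measurable_const)).inter
      (measurableSet_le (hsm n) measurable_const)
  have hsmono : ∀ n ω, s n ω ≤ s (n + 1) ω := fun n ω => by
    simp only [s]; rw [Finset.sum_range_succ _ (n + 1)]; exact le_self_add
  have hAanti : ∀ k n, A k (n + 1) ⊆ A k n := fun k n ω hω =>
    ⟨hω.1, (hsmono n ω).trans hω.2⟩
  have hαA : ∀ k n ω, ω ∈ A k n → α n ω ≠ ∞ := fun k n ω hω => by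
    refine ne_top_of_le_ne_top (ENNReal.natCast_ne_top k) (le_trans ?_ hω.2)
    exact le_self_add.trans (Finset.single_le_sum (f := fun j => α j ω + β j ω)
      (fun _ _ => zero_le) (Finset.self_mem_range_succ n))
  have main : ∀ k : ℕ, ∀ᵐ ω ∂P,
      (∃ c : ℝ, Tendsto (fun n => ((A k n).indicator (fun ω => V n ω / G n ω) ω).toReal)
        atTop (𝓝 c)) ∧ ∑' n, (A k n).indicator (fun ω => θ n ω / G (n + 1) ω) ω < ∞ := by
    intro k
    refine ae_tendsto_of_almost_supermartingale_of_bdd (𝓕 := 𝓕) (k := k)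
      (b := fun n => (A k n).indicator (β n))
      (ENNReal.natCast_ne_top k) (fun n => ((hV n).div (hGm' n)).indicator (hA k n))
      (fun n => (hβ n).indicator (hA k n))
      (fun n => ((hθ n).div ((hGm n).mono (𝓕.le n) le_rfl)).indicator (𝓕.le n _ (hA k n)))
      ?_ ?_ ?_
    · refine ne_top_of_le_ne_top (ENNReal.natCast_ne_top k) ?_
      calc _ ≤ ∫⁻ _, (k : ℝ≥0∞) ∂P := by
            refine lintegral_mono fun ω => ?_
            refine Set.indicator_apply_le' (fun hω => ?_) fun _ => zero_le
            simpa [G] using hω.1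
        _ = k := by simp
    · intro ω
      refine ENNReal.tsum_le_of_sum_range_le fun n => ?_
      induction n with
      | zero => simp
      | succ n ih =>
        by_cases hω : ω ∈ A k n
        · refine le_trans (Finset.sum_le_sum fun j _ => ?_) hω.2
          exact (Set.indicator_apply_le' (fun _ => le_rfl) fun _ => zero_le).trans le_add_self
        · rw [Finset.sum_range_succ, Set.indicator_of_notMem hω, add_zero]
          exact ih
    · intro n S hS
      -- This is an admissible weight at time n, because `G (n + 1)` only involves α up to index n.
      let η : Ω → ℝ≥0∞ := (S ∩ A k n).indicator fun ω => (G (n + 1) ω)⁻¹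
      have hη : Measurable[𝓕 n] η := (hGm n).inv.indicator (hS.inter (hA k n))
      rw [← lintegral_indicator (𝓕.le n _ hS), ← lintegral_indicator (𝓕.le n _ hS)]
      refine le_trans (lintegral_mono fun ω => ?_) ((h n η hη).trans (lintegral_mono fun ω => ?_))
      · by_cases hωS : ω ∈ S
        swap
        · simp [hωS]
        rw [Set.indicator_of_mem hωS]
        by_cases hωA : ω ∈ A k n
        · simp only [η, Set.indicator_of_mem (Set.mem_inter hωS hωA), Set.indicator_of_mem hωA,
            mul_add, ENNReal.div_eq_inv_mul]
          gcongr
          exact Set.indicator_apply_le' (fun _ => le_rfl) fun _ => zero_le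
        · have : ω ∉ A k (n + 1) := fun hc => hωA (hAanti k n hc)
          simp [hωA, this]
      · by_cases hωS : ω ∈ S
        swap
        · simp [η, hωS]
        rw [Set.indicator_of_mem hωS]
        by_cases hωA : ω ∈ A k n
        swap
        · simp [η, hωA]
        simp only [η, Set.indicator_of_mem (Set.mem_inter hωS hωA), Set.indicator_of_mem hωA,
            mul_add]
        gcongr
        · have hc0 : 1 + α n ω ≠ 0 := by simp
          have hct : 1 + α n ω ≠ ∞ := ENNReal.add_ne_top.2 ⟨ENNReal.one_ne_top, hαA k n ω hωA⟩
          have : G (n + 1) ω = G n ω * (1 + α n ω) := Finset.prod_range_succ _ _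
          rw [this, ENNReal.mul_inv (Or.inr hct) (Or.inr hc0), mul_assoc,
            ← mul_assoc (1 + α n ω)⁻¹, ENNReal.inv_mul_cancel hc0 hct, one_mul,
            ENNReal.div_eq_inv_mul]
        · exact mul_le_of_le_one_left' (ENNReal.inv_le_one.2 (hG1 _ _))
  filter_upwards [ae_all_iff.2 main, hαs, hβs] with ω hω hαω hβω
  have hfinite : V 0 ω + ∑' n, (α n ω + β n ω) ≠ ∞ := by
    rw [ENNReal.tsum_add]
    exact ENNReal.add_ne_top.2 ⟨hVtop 0 ω, ENNReal.add_ne_top.2 ⟨hαω.ne, hβω.ne⟩⟩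
  -- Almost every ω is never truncated once k is large. The products `G` then converge to a finite
  -- limit, which transfers the conclusions from V/G and θ/G back to V and θ.
  obtain ⟨k, hk⟩ := ENNReal.exists_nat_gt hfinite
  have hmem : ∀ n, ω ∈ A k n := fun n =>
    ⟨le_self_add.trans hk.le, (ENNReal.sum_le_tsum _).trans (le_add_self.trans hk.le)⟩
  obtain ⟨⟨c, hc⟩, hθω⟩ := hω k
  simp only [Set.indicator_of_mem (hmem _)] at hc hθω
  have hGreal : ∀ n, (G n ω).toReal = ∏ j ∈ Finset.range n, (1 + (α j ω).toReal) := by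
    intro n
    simp only [G, ENNReal.toReal_prod]
    refine Finset.prod_congr rfl fun j _ => ?_
    rw [ENNReal.toReal_add ENNReal.one_ne_top (hαA k j ω (hmem j)), ENNReal.toReal_one]
  have hGtop : ∀ n, G n ω ≠ ∞ := fun n => ENNReal.prod_ne_top fun j _ =>
    ENNReal.add_ne_top.2 ⟨ENNReal.one_ne_top, hαA k j ω (hmem j)⟩
  have hGlim := (Real.multipliable_one_add_of_summable
    (ENNReal.summable_toReal hαω.ne)).hasProd.tendsto_prod_nat
  simp only [← hGreal] at hGlim
  constructor
  · refine ⟨_, (hc.mul hGlim).congr fun n => ?_⟩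
    rw [ENNReal.toReal_div, div_mul_cancel₀]
    exact (ENNReal.toReal_pos (zero_lt_one.trans_le (hG1 n ω)).ne' (hGtop n)).ne'
  · obtain ⟨B, hB⟩ := hGlim.bddAbove_range
    have hGB : ∀ n, G n ω ≤ ENNReal.ofReal B := fun n => by
      rw [← ENNReal.ofReal_toReal (hGtop n)]
      exact ENNReal.ofReal_le_ofReal (hB ⟨n, rfl⟩)
    calc ∑' n, θ n ω ≤ ∑' n, ENNReal.ofReal B * (θ n ω / G (n + 1) ω) := by
          refine ENNReal.tsum_le_tsum fun n => ?_
          calc θ n ω = G (n + 1) ω * (θ n ω / G (n + 1) ω) :=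
                (ENNReal.mul_div_cancel (zero_lt_one.trans_le (hG1 _ ω)).ne' (hGtop _)).symm
            _ ≤ _ := by gcongr; exact hGB _
      _ = ENNReal.ofReal B * ∑' n, θ n ω / G (n + 1) ω := ENNReal.tsum_mul_left
      _ < ∞ := ENNReal.mul_lt_top ENNReal.ofReal_lt_top hθω

end RobbinsSiegmund

/-! ### Subdifferentials, proximity operators and conjugates. -/

section Convex

variable {E : Type*} [NormedAddCommGroup E] [InnerProductSpace ℝ E] {f : E → EReal}

theorem coe_sum_ereal {ι : Type*} (s : Finset ι) (a : ι → ℝ) :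
    ((∑ i ∈ s, a i : ℝ) : EReal) = ∑ i ∈ s, (a i : EReal) := by
  classical
  induction s using Finset.induction_on with
  | empty => simp
  | insert i s hi ih => rw [Finset.sum_insert hi, Finset.sum_insert hi, EReal.coe_add, ih]

theorem GammaZero.const_mul (hf : GammaZero f) {γ : ℝ} (hγ : 0 < γ) :
    GammaZero fun t => (γ : EReal) * f t := by
  have hmono : Monotone fun a : EReal => (γ : EReal) * a := fun a b hab =>
    mul_le_mul_of_nonneg_left hab (EReal.coe_nonneg.2 hγ.le)
  have hreal : ∀ x, f x ≠ ⊤ → ∃ r : ℝ, f x = r := fun x hx =>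
    ⟨(f x).toReal, (EReal.coe_toReal hx (hf.ne_bot x)).symm⟩
  refine ⟨fun x => ?_, ?_, ?_, fun x y α β hα hβ hαβ => ?_⟩
  · by_cases hx : f x = ⊤
    · rw [hx, EReal.coe_mul_top_of_pos hγ]; exact top_ne_bot
    · obtain ⟨r, hr⟩ := hreal x hx
      rw [hr, ← EReal.coe_mul]; exact EReal.coe_ne_bot _
  · obtain ⟨x, hx⟩ := hf.proper
    obtain ⟨r, hr⟩ := hreal x hx
    exact ⟨x, by rw [hr, ← EReal.coe_mul]; exact EReal.coe_ne_top _⟩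
  · refine Continuous.comp_lowerSemicontinuous (g := fun a : EReal => (γ : EReal) * a) ?_ hf.lsc hmono
    refine continuous_iff_continuousAt.2 fun a => ?_
    have h0 : (γ : EReal) ≠ 0 := by simpa using hγ.ne'
    exact (EReal.continuousAt_mul (p := ((γ : EReal), a)) (Or.inl h0) (Or.inl h0)
      (Or.inl (EReal.coe_ne_bot γ)) (Or.inl (EReal.coe_ne_top γ))).comp (by fun_prop)
  · refine (hmono (hf.convex x y α β hα hβ hαβ)).trans ?_
    dsimp only
    rw [EReal.left_distrib_of_nonneg_of_ne_top (EReal.coe_nonneg.2 hγ.le) (EReal.coe_ne_top _),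
      mul_left_comm, mul_left_comm (γ : EReal)]

/-- Properness excludes the value +∞ at a point having a subgradient; subgradient arguments can then
be carried out in ℝ. -/
theorem GammaZero.exists_real_of_mem_subdiff (hf : GammaZero f) {x u : E} (hu : u ∈ subdiff f x) :
    ∃ t : ℝ, f x = t ∧ ∀ y, ((t + ⟪y - x, u⟫_ℝ : ℝ) : EReal) ≤ f y := by
  have hx : f x ≠ ⊤ := by
    intro hx
    obtain ⟨y, hy⟩ := hf.proper
    have h := hu y
    rw [hx, EReal.coe_add_top, top_le_iff] at h
    exact hy h
  refine ⟨(f x).toReal, (EReal.coe_toReal hx (hf.ne_bot x)).symm, fun y => ?_⟩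
  rw [add_comm, EReal.coe_add, EReal.coe_toReal hx (hf.ne_bot x)]
  exact hu y

theorem mem_subdiff_of_real {x u : E} {t : ℝ} (ht : f x = t)
    (h : ∀ y, ((t + ⟪y - x, u⟫_ℝ : ℝ) : EReal) ≤ f y) : u ∈ subdiff f x := by
  intro y
  rw [ht, ← EReal.coe_add, add_comm]
  exact h y

theorem GammaZero.subdiff_monotone (hf : GammaZero f) {x u x' u' : E} (hu : u ∈ subdiff f x)
    (hu' : u' ∈ subdiff f x') : 0 ≤ ⟪u - u', x - x'⟫_ℝ := by
  obtain ⟨t, ht, h⟩ := hf.exists_real_of_mem_subdiff hu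
  obtain ⟨t', ht', h'⟩ := hf.exists_real_of_mem_subdiff hu'
  have h1 := h x'
  have h2 := h' x
  rw [ht', EReal.coe_le_coe_iff] at h1
  rw [ht, EReal.coe_le_coe_iff] at h2
  have e1 : ⟪x' - x, u⟫_ℝ = - ⟪u, x - x'⟫_ℝ := by
    rw [real_inner_comm, ← inner_neg_right, neg_sub]
  have e2 : ⟪x - x', u'⟫_ℝ = ⟪u', x - x'⟫_ℝ := real_inner_comm _ _
  rw [inner_sub_left]
  linarith

theorem GammaZero.mem_subdiff_const_mul_iff (hf : GammaZero f) {γ : ℝ} (hγ : 0 < γ) {x u : E} :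
    u ∈ subdiff (fun t => (γ : EReal) * f t) x ↔ γ⁻¹ • u ∈ subdiff f x := by
  have key : ∀ (γ : ℝ), 0 < γ → ∀ (f : E → EReal), GammaZero f → ∀ x u : E, u ∈ subdiff f x →
      γ • u ∈ subdiff (fun t => (γ : EReal) * f t) x := by
    intro γ hγ f hf x u hu
    obtain ⟨t, ht, h⟩ := hf.exists_real_of_mem_subdiff hu
    refine mem_subdiff_of_real (t := γ * t) (by simp only [ht, EReal.coe_mul]) fun y => ?_
    refine le_trans (le_of_eq ?_) (mul_le_mul_of_nonneg_left (h y) (EReal.coe_nonneg.2 hγ.le))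
    rw [← EReal.coe_mul, inner_smul_right, mul_add]
  constructor
  · intro hu
    have h := key γ⁻¹ (inv_pos.2 hγ) _ (hf.const_mul hγ) x u hu
    simpa only [← mul_assoc, ← EReal.coe_mul, inv_mul_cancel₀ hγ.ne', EReal.coe_one, one_mul] using h
  · intro hu
    have h := key γ hγ f hf x _ hu
    rwa [smul_smul, mul_inv_cancel₀ hγ.ne', one_smul] at h

theorem GammaZero.convex_real (hf : GammaZero f) {x y : E} {s t : ℝ} (hx : f x = s) (hy : f y = t)
    {α β : ℝ} (hα : 0 < α) (hβ : 0 < β) (hαβ : α + β = 1) :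
    ∃ r : ℝ, f (α • x + β • y) = r ∧ r ≤ α * s + β * t := by
  have h := hf.convex x y α β hα hβ hαβ
  rw [hx, hy, ← EReal.coe_mul, ← EReal.coe_mul, ← EReal.coe_add] at h
  have hr := EReal.coe_toReal (ne_top_of_le_ne_top (EReal.coe_ne_top _) h) (hf.ne_bot _)
  refine ⟨_, hr.symm, ?_⟩
  rwa [← hr, EReal.coe_le_coe_iff] at h

/-- Midpoint convexity and the parallelogram law make a minimizing sequence Cauchy, and lower
semicontinuity passes to its limit. The one given subgradient supplies the affine minorant that
bounds the objective below. -/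
theorem GammaZero.exists_prox [CompleteSpace E] (hf : GammaZero f)
    (hs : ∃ x u, u ∈ subdiff f x) (x : E) :
    ∃ q : E, ∀ y : E,
      f q + ((‖x - q‖ ^ 2 / 2 : ℝ) : EReal) ≤ f y + ((‖x - y‖ ^ 2 / 2 : ℝ) : EReal) := by
  obtain ⟨x₀, u₀, hu₀⟩ := hs
  obtain ⟨t₀, ht₀, hmin⟩ := hf.exists_real_of_mem_subdiff hu₀
  let S : Set ℝ := {r | ∃ y t, f y = ((t : ℝ) : EReal) ∧ r = t + ‖x - y‖ ^ 2 / 2}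
  have hSne : S.Nonempty := ⟨_, x₀, t₀, ht₀, rfl⟩
  have hSbdd : BddBelow S := by
    -- This is the minimum over y of the affine minorant plus ‖x - y‖²/2, attained at y = x - u₀.
    refine ⟨t₀ + ⟪x - x₀, u₀⟫_ℝ - ‖u₀‖ ^ 2 / 2, ?_⟩
    rintro _ ⟨y, t, hy, rfl⟩
    have h1 := hmin y
    rw [hy, EReal.coe_le_coe_iff] at h1
    have h2 : ⟪y - x₀, u₀⟫_ℝ = ⟪x - x₀, u₀⟫_ℝ - ⟪x - y, u₀⟫_ℝ := by
      rw [← inner_sub_left]; congr 1; abel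
    have h3 := norm_sub_sq_real (x - y) u₀
    nlinarith [sq_nonneg ‖x - y - u₀‖]
  have hex : ∀ n : ℕ, ∃ y t, f y = ((t : ℝ) : EReal) ∧
      t + ‖x - y‖ ^ 2 / 2 < sInf S + 1 / ((n : ℝ) + 1) := by
    intro n
    obtain ⟨r, ⟨y, t, hy, rfl⟩, hlt⟩ := exists_lt_of_csInf_lt hSne
      (lt_add_of_pos_right (sInf S) (Nat.one_div_pos_of_nat (α := ℝ) (n := n)))
    exact ⟨y, t, hy, hlt⟩
  choose y t hy hlt using hex
  have hdist : ∀ n k, ‖y n - y k‖ ^ 2 ≤ 4 * (1 / ((n : ℝ) + 1) + 1 / ((k : ℝ) + 1)) := by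
    intro n k
    obtain ⟨r, hr, hrle⟩ := hf.convex_real (hy n) (hy k) (α := 1 / 2) (β := 1 / 2) (by norm_num)
      (by norm_num) (by norm_num)
    have hm := csInf_le hSbdd ⟨_, r, hr, rfl⟩
    have hp := parallelogram_law_with_norm ℝ (x - y n) (x - y k)
    have e1 : x - y n + (x - y k) = (2 : ℝ) • (x - ((1 / 2 : ℝ) • y n + (1 / 2 : ℝ) • y k)) := by
      module
    have e2 : x - y n - (x - y k) = -(y n - y k) := by abel
    rw [e1, e2, norm_neg, norm_smul, Real.norm_ofNat] at hp
    have h1 := hlt n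
    have h2 := hlt k
    nlinarith
  have hcauchy : CauchySeq y := by
    rw [Metric.cauchySeq_iff']
    intro ε hε
    obtain ⟨n, hn⟩ := exists_nat_one_div_lt (show (0 : ℝ) < ε ^ 2 / 8 by positivity)
    refine ⟨n, fun k hk => ?_⟩
    rw [dist_eq_norm]
    have h1 := hdist k n
    have h2 : 1 / ((k : ℝ) + 1) ≤ 1 / ((n : ℝ) + 1) := Nat.one_div_le_one_div hk
    refine lt_of_pow_lt_pow_left₀ 2 hε.le ?_
    linarith
  obtain ⟨q, hq⟩ := cauchySeq_tendsto_of_complete hcauchy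
  have hfq : f q ≤ ((sInf S - ‖x - q‖ ^ 2 / 2 : ℝ) : EReal) := by
    refine EReal.ge_of_forall_gt_iff_ge.1 fun c hc => ?_
    rw [EReal.coe_le_coe_iff]
    have hlim : Tendsto (fun n : ℕ => sInf S + 1 / ((n : ℝ) + 1) - ‖x - y n‖ ^ 2 / 2) atTop
        (𝓝 (sInf S + 0 - ‖x - q‖ ^ 2 / 2)) :=
      (tendsto_const_nhds.add tendsto_one_div_add_atTop_nhds_zero_nat).sub
        ((((tendsto_const_nhds.sub hq).norm).pow 2).div_const 2)
    rw [add_zero] at hlim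
    refine ge_of_tendsto hlim ?_
    filter_upwards [hq.eventually (hf.lsc q c hc)] with n hn
    rw [hy n, gt_iff_lt, EReal.coe_lt_coe_iff] at hn
    linarith [hlt n]
  refine ⟨q, fun z => ?_⟩
  calc f q + ((‖x - q‖ ^ 2 / 2 : ℝ) : EReal)
      ≤ ((sInf S - ‖x - q‖ ^ 2 / 2 : ℝ) : EReal) + ((‖x - q‖ ^ 2 / 2 : ℝ) : EReal) := by gcongr
    _ = ((sInf S : ℝ) : EReal) := by rw [← EReal.coe_add, sub_add_cancel]
    _ ≤ _ := by
      by_cases hz : f z = ⊤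
      · rw [hz, EReal.top_add_coe]; exact le_top
      · have hr := EReal.coe_toReal hz (hf.ne_bot z)
        rw [← hr, ← EReal.coe_add, EReal.coe_le_coe_iff]
        exact csInf_le hSbdd ⟨z, _, hr.symm, rfl⟩

/-- Compare the minimizer q with (1 - τ)q + τy, use convexity, divide by τ and let τ tend to 0. -/
theorem GammaZero.sub_prox_mem_subdiff [CompleteSpace E] (hf : GammaZero f)
    (hs : ∃ x u, u ∈ subdiff f x) (x : E) : x - prox f x ∈ subdiff f (prox f x) := by
  have hq : ∀ y : E, f (prox f x) + ((‖x - prox f x‖ ^ 2 / 2 : ℝ) : EReal) ≤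
      f y + ((‖x - y‖ ^ 2 / 2 : ℝ) : EReal) := Classical.epsilon_spec (hf.exists_prox hs x)
  generalize prox f x = q at hq
  have hqtop : f q ≠ ⊤ := by
    intro h
    obtain ⟨y, hy⟩ := hf.proper
    have h1 := hq y
    rw [h, EReal.top_add_coe, top_le_iff, ← EReal.coe_toReal hy (hf.ne_bot y),
      ← EReal.coe_add] at h1
    exact EReal.coe_ne_top _ h1
  obtain ⟨t, ht⟩ : ∃ t : ℝ, f q = t := ⟨_, (EReal.coe_toReal hqtop (hf.ne_bot q)).symm⟩
  refine mem_subdiff_of_real ht fun y => ?_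
  by_cases hy : f y = ⊤
  · rw [hy]; exact le_top
  obtain ⟨s, hs⟩ : ∃ s : ℝ, f y = s := ⟨_, (EReal.coe_toReal hy (hf.ne_bot y)).symm⟩
  rw [hs, EReal.coe_le_coe_iff]
  have key : ∀ τ : ℝ, 0 < τ → τ < 1 → t + ⟪y - q, x - q⟫_ℝ - s ≤ τ * (‖y - q‖ ^ 2 / 2) := by
    intro τ h0 h1
    obtain ⟨r, hr, hrle⟩ := hf.convex_real ht hs (sub_pos.2 h1) h0 (by ring)
    have h2 := hq ((1 - τ) • q + τ • y)
    rw [ht, hr, ← EReal.coe_add, ← EReal.coe_add, EReal.coe_le_coe_iff] at h2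
    have e : x - ((1 - τ) • q + τ • y) = (x - q) - τ • (y - q) := by module
    rw [e, norm_sub_sq_real (x - q), inner_smul_right, norm_smul, mul_pow, Real.norm_eq_abs, sq_abs,
      real_inner_comm] at h2
    have h3 : τ * (t + ⟪y - q, x - q⟫_ℝ - s) ≤ τ * (τ * (‖y - q‖ ^ 2 / 2)) := by nlinarith
    exact le_of_mul_le_mul_left h3 h0
  have hlim : Tendsto (fun n : ℕ => (1 / ((n : ℝ) + 1)) * (‖y - q‖ ^ 2 / 2)) atTop
      (𝓝 (0 * (‖y - q‖ ^ 2 / 2))) := tendsto_one_div_add_atTop_nhds_zero_nat.mul_const _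
  rw [zero_mul] at hlim
  have h := ge_of_tendsto hlim (b := t + ⟪y - q, x - q⟫_ℝ - s) (by
    -- The index n = 0 gives τ = 1, which is excluded.
    filter_upwards [eventually_gt_atTop 0] with n hn
    refine key _ Nat.one_div_pos_of_nat ?_
    rw [div_lt_one (by positivity)]
    exact_mod_cast Nat.lt_add_of_pos_left hn)
  linarith

/-- Monotonicity of the subdifferential makes the solution q of x - q ∈ ∂f(q) unique. -/
theorem GammaZero.prox_eq_of_mem_subdiff [CompleteSpace E] (hf : GammaZero f) {x q : E}
    (h : x - q ∈ subdiff f q) : prox f x = q := by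
  have h1 := hf.subdiff_monotone (hf.sub_prox_mem_subdiff ⟨_, _, h⟩ x) h
  have e : x - prox f x - (x - q) = -(prox f x - q) := by abel
  rw [e, inner_neg_left, real_inner_self_eq_norm_sq] at h1
  have h2 : ‖prox f x - q‖ = 0 := by nlinarith [norm_nonneg (prox f x - q)]
  exact sub_eq_zero.1 (norm_eq_zero.1 h2)

/-- With d = x - x' and a the difference of the proximal points, monotonicity says ⟪d - a, a⟫ ≥ 0,
while ‖2a - d‖² = ‖d‖² - 4⟪d - a, a⟫. -/
theorem GammaZero.norm_reflected_prox_sub_le [CompleteSpace E] (hf : GammaZero f)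
    (hs : ∃ x u, u ∈ subdiff f x) (x x' : E) :
    ‖((2 : ℝ) • prox f x - x) - ((2 : ℝ) • prox f x' - x')‖ ≤ ‖x - x'‖ := by
  have h := hf.subdiff_monotone (hf.sub_prox_mem_subdiff hs x) (hf.sub_prox_mem_subdiff hs x')
  set a := prox f x - prox f x' with ha
  have e1 : x - prox f x - (x' - prox f x') = (x - x') - a := by rw [ha]; abel
  have e2 : ((2 : ℝ) • prox f x - x) - ((2 : ℝ) • prox f x' - x') = (2 : ℝ) • a - (x - x') := by
    rw [ha]; module
  rw [e1, inner_sub_left, real_inner_self_eq_norm_sq] at h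
  rw [e2]
  refine le_of_sq_le_sq ?_ (norm_nonneg _)
  rw [norm_sub_sq_real, inner_smul_left, norm_smul, real_inner_comm]
  simp only [conj_trivial, Real.norm_ofNat]
  nlinarith

theorem GammaZero.norm_prox_sub_le [CompleteSpace E] (hf : GammaZero f)
    (hs : ∃ x u, u ∈ subdiff f x) (x x' : E) : ‖prox f x - prox f x'‖ ≤ ‖x - x'‖ := by
  have h := hf.norm_reflected_prox_sub_le hs x x'
  have e : prox f x - prox f x' = (1 / 2 : ℝ) • ((((2 : ℝ) • prox f x - x) -
      ((2 : ℝ) • prox f x' - x')) + (x - x')) := by module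
  rw [e, norm_smul, Real.norm_of_nonneg (by norm_num)]
  have := norm_add_le (((2 : ℝ) • prox f x - x) - ((2 : ℝ) • prox f x' - x')) (x - x')
  linarith

theorem GammaZero.continuous_prox [CompleteSpace E] (hf : GammaZero f)
    (hs : ∃ x u, u ∈ subdiff f x) : Continuous (prox f) := by
  refine (LipschitzWith.of_dist_le_mul (K := 1) fun x x' => ?_).continuous
  simpa [dist_eq_norm] using hf.norm_prox_sub_le hs x x'

theorem GammaZero.le_fenchelConj {x : E} {t : ℝ} (ht : f x = t) (u : E) :
    ((⟪x, u⟫_ℝ - t : ℝ) : EReal) ≤ fenchelConj f u := by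
  refine le_trans (le_of_eq ?_) (le_iSup _ x)
  rw [ht, EReal.coe_sub]

/-- The equality case of Fenchel–Young: the affine minorant bounds every term of the supremum.
`GammaZero.le_fenchelConj` is the reverse bound. -/
theorem GammaZero.fenchelConj_le (hf : GammaZero f) {x u : E} {t : ℝ}
    (h : ∀ y, ((t + ⟪y - x, u⟫_ℝ : ℝ) : EReal) ≤ f y) :
    fenchelConj f u ≤ ((⟪x, u⟫_ℝ - t : ℝ) : EReal) := by
  refine iSup_le fun y => ?_
  by_cases hy : f y = ⊤
  · rw [hy, EReal.sub_top]; exact bot_le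
  have hr := EReal.coe_toReal hy (hf.ne_bot y)
  have h1 := h y
  rw [← hr, EReal.coe_le_coe_iff, inner_sub_left] at h1
  rw [← hr, ← EReal.coe_sub, EReal.coe_le_coe_iff]
  linarith

end Convex

/-! ### Karush–Kuhn–Tucker conditions and duality. -/

section Optimality

variable {m p : ℕ} {H : Fin m → Type*} {G : Fin p → Type*}
  [∀ i, NormedAddCommGroup (H i)] [∀ i, InnerProductSpace ℝ (H i)] [∀ i, CompleteSpace (H i)]
  [∀ k, NormedAddCommGroup (G k)] [∀ k, InnerProductSpace ℝ (G k)] [∀ k, CompleteSpace (G k)]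
  {f : ∀ i, H i → EReal} {g : ∀ k, G k → EReal} {L : ∀ k i, H i →L[ℝ] G k}

theorem sum_inner_adjoint (x : ∀ i, H i) (v : ∀ k, G k) :
    ∑ i, ⟪x i, -∑ k, ContinuousLinearMap.adjoint (L k i) (v k)⟫_ℝ =
      -∑ k, ⟪∑ i, L k i (x i), v k⟫_ℝ := by
  simp only [inner_neg_right, inner_sum, sum_inner, Finset.sum_neg_distrib,
    ContinuousLinearMap.adjoint_inner_right]
  rw [Finset.sum_comm]

/-- The Karush–Kuhn–Tucker conditions imply primal and dual optimality. -/
theorem mem_solutions_of_kkt (hf : ∀ i, GammaZero (f i)) (hg : ∀ k, GammaZero (g k))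
    {z : PiLp 2 H} {v : PiLp 2 G} (hv : ∀ k, v k ∈ subdiff (g k) (∑ i, L k i (z i)))
    (hu : ∀ i, -∑ k, ContinuousLinearMap.adjoint (L k i) (v k) ∈ subdiff (f i) (z i)) :
    z ∈ primalSolutions f g L ∧ v ∈ dualSolutions f g L := by
  choose t ht h using fun i => (hf i).exists_real_of_mem_subdiff (hu i)
  choose r hr h' using fun k => (hg k).exists_real_of_mem_subdiff (hv k)
  constructor
  · intro x'
    calc primalObjective f g L z = ((∑ i, t i + ∑ k, r k : ℝ) : EReal) := by
          simp only [primalObjective, ht, hr, EReal.coe_add, coe_sum_ereal]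
      _ = ((∑ i, (t i + ⟪x' i - z i, -∑ k, ContinuousLinearMap.adjoint (L k i) (v k)⟫_ℝ) +
            ∑ k, (r k + ⟪∑ i, L k i (x' i) - ∑ i, L k i (z i), v k⟫_ℝ) : ℝ) : EReal) := by
          congr 1
          rw [Finset.sum_add_distrib, Finset.sum_add_distrib,
            sum_inner_adjoint (fun i => x' i - z i) v]
          simp only [map_sub, Finset.sum_sub_distrib]
          ring
      _ ≤ primalObjective f g L x' := by
          rw [EReal.coe_add, coe_sum_ereal, coe_sum_ereal]
          exact add_le_add (Finset.sum_le_sum fun i _ => h i _)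
            (Finset.sum_le_sum fun k _ => h' k _)
  -- The terms linear in w cancel, so the Fenchel–Young lower bound taken at z and L z does not
  -- depend on w. It is attained at v.
  · have hval : ∀ w : PiLp 2 G,
        ((∑ i, (⟪z i, -∑ k, ContinuousLinearMap.adjoint (L k i) (w k)⟫_ℝ - t i) +
          ∑ k, (⟪∑ i, L k i (z i), w k⟫_ℝ - r k) : ℝ) : EReal) =
        ((-∑ i, t i - ∑ k, r k : ℝ) : EReal) := by
      intro w
      congr 1
      rw [Finset.sum_sub_distrib, Finset.sum_sub_distrib, sum_inner_adjoint (fun i => z i) w]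
      ring
    intro w
    calc dualObjective f g L v ≤ ((-∑ i, t i - ∑ k, r k : ℝ) : EReal) := by
          rw [← hval v, EReal.coe_add, coe_sum_ereal, coe_sum_ereal]
          exact add_le_add (Finset.sum_le_sum fun i _ => (hf i).fenchelConj_le (h i))
            (Finset.sum_le_sum fun k _ => (hg k).fenchelConj_le (h' k))
      _ ≤ dualObjective f g L w := by
          rw [← hval w, EReal.coe_add, coe_sum_ereal, coe_sum_ereal]
          exact add_le_add (Finset.sum_le_sum fun i _ => GammaZero.le_fenchelConj (ht i) _)
            (Finset.sum_le_sum fun k _ => GammaZero.le_fenchelConj (hr k) _)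

end Optimality

/-! ### One randomly activated step in the weighted norm. -/

section BlockIteration

/-- Moving y changes all the distances by at most the displacement, so the Cauchy property survives
limits. This extends convergence from a countable dense set of fixed points to all of them. -/
theorem isClosed_setOf_exists_tendsto_norm_sub {F : Type*} [NormedAddCommGroup F] (w : ℕ → F) :
    IsClosed {y | ∃ l : ℝ, Tendsto (fun n => ‖w n - y‖) atTop (𝓝 l)} := by
  refine isClosed_of_closure_subset fun y hy => ?_
  refine cauchySeq_tendsto_of_complete (Metric.cauchySeq_iff'.2 fun ε hε => ?_)
  obtain ⟨y', ⟨l, hl⟩, hyy'⟩ := Metric.mem_closure_iff.1 hy (ε / 3) (by positivity)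
  obtain ⟨n₀, hn₀⟩ := Metric.cauchySeq_iff'.1 hl.cauchySeq (ε / 3) (by positivity)
  refine ⟨n₀, fun n hn => ?_⟩
  have h1 : ∀ n, |‖w n - y‖ - ‖w n - y'‖| ≤ dist y y' := fun n => by
    refine (abs_norm_sub_norm_le _ _).trans (le_of_eq ?_)
    rw [dist_eq_norm, sub_sub_sub_cancel_left, norm_sub_rev]
  have h2 := hn₀ n hn
  rw [Real.dist_eq] at h2 ⊢
  have h3 := abs_le.1 (h1 n)
  have h4 := abs_le.1 (h1 n₀)
  have h5 := abs_lt.1 h2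
  rw [abs_lt]
  constructor <;> linarith [h3.1, h3.2, h4.1, h4.2, h5.1, h5.2]

/-- Young's inequality with a free weight. Taking ξ to be the conditional root mean square bound on
the error gives perturbations ξ and (1 + ξ⁻¹)ξ² = ξ + ξ², both summable. -/
theorem ennreal_add_sq_le (r e ξ : ℝ≥0∞) (hξ : ξ ≠ 0) :
    (r + e) ^ 2 ≤ (1 + ξ) * r ^ 2 + (1 + ξ⁻¹) * e ^ 2 := by
  have hr2 : ∀ a : ℝ≥0∞, a ≠ 0 → a ^ 2 ≠ 0 := fun _ ha => pow_ne_zero 2 ha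
  by_cases hξt : ξ = ∞
  · by_cases hr : r = 0
    · simp [hr, hξt]
    · rw [hξt, add_top, ENNReal.top_mul (hr2 r hr), top_add]; exact le_top
  by_cases hrt : r = ∞
  · refine le_top.trans_eq ?_
    rw [hrt, ENNReal.top_pow two_ne_zero, ENNReal.mul_top (by simp), top_add]
  by_cases het : e = ∞
  · refine le_top.trans_eq ?_
    rw [het, ENNReal.top_pow two_ne_zero, ENNReal.mul_top (by simp), add_top]
  lift r to NNReal using hrt
  lift e to NNReal using het
  lift ξ to NNReal using hξt
  have hξ0 : ξ ≠ 0 := by exact_mod_cast hξ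
  rw [← ENNReal.coe_inv hξ0]
  norm_cast
  rw [← NNReal.coe_le_coe]
  push_cast
  have hpos : (0 : ℝ) < ξ := lt_of_le_of_ne ξ.2 (fun h => hξ0 (NNReal.coe_injective h.symm))
  have h : 2 * (r : ℝ) * e ≤ ξ * r ^ 2 + (ξ : ℝ)⁻¹ * e ^ 2 := by
    have h1 : (ξ : ℝ) * r ^ 2 + (ξ : ℝ)⁻¹ * e ^ 2 - 2 * r * e = (ξ : ℝ)⁻¹ * (ξ * r - e) ^ 2 := by
      field_simp
      ring
    have h2 : (0 : ℝ) ≤ (ξ : ℝ)⁻¹ * (ξ * r - e) ^ 2 := by positivity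
    linarith
  linarith

variable {Ω : Type*} {mΩ : MeasurableSpace Ω} {P : Measure Ω}

theorem setLIntegral_of_indep {𝓖 𝓐 : MeasurableSpace Ω} (h𝓖 : 𝓖 ≤ mΩ) (h𝓐 : 𝓐 ≤ mΩ)
    (hind : Indep 𝓖 𝓐 P) {B : Set Ω} (hB : MeasurableSet[𝓖] B) {η : Ω → ℝ≥0∞}
    (hη : Measurable[𝓐] η) : ∫⁻ ω in B, η ω ∂P = P B * ∫⁻ ω, η ω ∂P := by
  have h := lintegral_mul_eq_lintegral_mul_lintegral_of_independent_measurableSpace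
    (f := B.indicator fun _ => 1) (g := η) h𝓖 h𝓐 hind (measurable_const.indicator hB) hη
  rw [lintegral_indicator_const (h𝓖 _ hB), one_mul] at h
  rw [← h, ← lintegral_indicator (h𝓖 _ hB)]
  refine lintegral_congr fun ω => ?_
  by_cases hω : ω ∈ B <;> simp [hω]

open Classical in
theorem lintegral_ite_of_indep [IsProbabilityMeasure P] {𝓖 𝓐 : MeasurableSpace Ω} (h𝓖 : 𝓖 ≤ mΩ) (h𝓐 : 𝓐 ≤ mΩ)
    (hind : Indep 𝓖 𝓐 P) {B : Set Ω} (hB : MeasurableSet[𝓖] B) {q : ℝ} (hq0 : 0 ≤ q)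
    (hq : P B = ENNReal.ofReal q)
    {a b : Ω → ℝ≥0∞} (ha : Measurable[𝓐] a) (hb : Measurable[𝓐] b) :
    ∫⁻ ω, (if ω ∈ B then b ω else a ω) ∂P =
      ∫⁻ ω, (ENNReal.ofReal q * b ω + ENNReal.ofReal (1 - q) * a ω) ∂P := by
  have hB' := h𝓖 _ hB
  rw [← lintegral_add_compl _ hB']
  have e1 : ∫⁻ ω in B, (if ω ∈ B then b ω else a ω) ∂P = ∫⁻ ω in B, b ω ∂P :=
    setLIntegral_congr_fun hB' fun ω hω => if_pos hω
  have e2 : ∫⁻ ω in Bᶜ, (if ω ∈ B then b ω else a ω) ∂P = ∫⁻ ω in Bᶜ, a ω ∂P :=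
    setLIntegral_congr_fun hB'.compl fun ω hω => if_neg hω
  rw [e1, e2, setLIntegral_of_indep h𝓖 h𝓐 hind hB hb, setLIntegral_of_indep h𝓖 h𝓐 hind hB.compl ha,
    prob_compl_eq_one_sub hB', hq, ENNReal.ofReal_sub _ hq0, ENNReal.ofReal_one,
    lintegral_add_left ((hb.mono h𝓐 le_rfl).const_mul _), lintegral_const_mul _ (hb.mono h𝓐 le_rfl),
    lintegral_const_mul _ (ha.mono h𝓐 le_rfl)]

theorem lintegral_sum_mul_add {J : Type*} [Fintype J] (c : J → ℝ≥0∞) {F : J → Ω → ℝ≥0∞}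
    {g : Ω → ℝ≥0∞} (r : Ω → ℝ≥0∞) (hF : ∀ j, Measurable (F j)) (hg : Measurable g) :
    ∫⁻ ω, (∑ j, c j * (F j ω + g ω) + r ω) ∂P =
      ∑ j, c j * (∫⁻ ω, F j ω ∂P + ∫⁻ ω, g ω ∂P) + ∫⁻ ω, r ω ∂P := by
  have hm : ∀ j, Measurable fun ω => c j * (F j ω + g ω) := fun j => ((hF j).add hg).const_mul _
  rw [lintegral_add_left (Finset.measurable_fun_sum _ fun j _ => hm j),
    lintegral_finsetSum _ fun j _ => hm j]
  congr 1
  refine Finset.sum_congr rfl fun j _ => ?_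
  rw [← lintegral_add_left (hF j)]
  exact lintegral_const_mul _ ((hF j).add hg)

variable {K : Type*} [NormedAddCommGroup K] [InnerProductSpace ℝ K] {J : Type*} [Fintype J]

/-- The effect of a relaxed nonexpansive step on the distance to a fixed point. -/
theorem norm_relaxed_sub_sq_le {N : K → K} (hN : ∀ s t, ‖N s - N t‖ ≤ ‖s - t‖) {x : K}
    (hx : N x = x) {l : ℝ} (hl0 : 0 ≤ l) (s : K) :
    ‖s + l • (N s - s) - x‖ ^ 2 ≤ ‖s - x‖ ^ 2 - l * (1 - l) * ‖N s - s‖ ^ 2 := by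
  have h1 := hN s x
  rw [hx] at h1
  have h2 : ‖N s - x‖ ^ 2 ≤ ‖s - x‖ ^ 2 := by gcongr
  have e1 : N s - x = (s - x) + (N s - s) := by abel
  have e2 : s + l • (N s - s) - x = (s - x) + l • (N s - s) := by abel
  rw [e1, norm_add_sq_real] at h2
  rw [e2, norm_add_sq_real, inner_smul_right, norm_smul, mul_pow, Real.norm_eq_abs, sq_abs]
  nlinarith

open Classical in
/-- The stochastic quasi-Fejér inequality for a randomly activated block iteration. -/
theorem lintegral_weighted_dist_le [IsProbabilityMeasure P] [MeasurableSpace K] [BorelSpace K]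
    {Q : J → K →L[ℝ] K} (hQ : ∀ s, ∑ j, ‖Q j s‖ ^ 2 = ‖s‖ ^ 2) {N : K → K}
    (hN : ∀ s t, ‖N s - N t‖ ≤ ‖s - t‖) {x : K} (hx : N x = x)
    {𝓖 𝓐 : MeasurableSpace Ω} (h𝓖 : 𝓖 ≤ mΩ) (h𝓐 : 𝓐 ≤ mΩ) (hind : Indep 𝓖 𝓐 P)
    {B : J → Set Ω} (hB : ∀ j, MeasurableSet[𝓖] (B j)) {q : J → ℝ} (hq0 : ∀ j, 0 < q j)
    (hq1 : ∀ j, q j ≤ 1)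
    (hq : ∀ j, P (B j) = ENNReal.ofReal (q j)) {l κ : ℝ} (hl : l ∈ Set.Ioo (0 : ℝ) 1)
    (hκ0 : 0 ≤ κ) (hκ : κ ≤ l * (1 - l)) {s s' : Ω → K} (hs : Measurable[𝓐] s)
    {e : J → Ω → K} {E ξ : Ω → ℝ≥0∞} (heE : ∀ j ω, ‖e j ω‖ₑ ≤ E ω) (hE : Measurable[mΩ] E)
    (hξ : Measurable[𝓐] ξ) (hξ0 : ∀ ω, ξ ω ≠ 0)
    (hEξ : ∀ η : Ω → ℝ≥0∞, Measurable[𝓐] η →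
      ∫⁻ ω, η ω * E ω ^ 2 ∂P ≤ ∫⁻ ω, η ω * ξ ω ^ 2 ∂P)
    (hupd : ∀ ω j, Q j (s' ω) =
      if ω ∈ B j then Q j (s ω) + l • (Q j (N (s ω) - s ω) + e j ω) else Q j (s ω))
    {η : Ω → ℝ≥0∞} (hη : Measurable[𝓐] η) :
    ∫⁻ ω, η ω * (ENNReal.ofReal (∑ j, (q j)⁻¹ * ‖Q j (s' ω - x)‖ ^ 2) +
        ENNReal.ofReal (κ * ‖N (s ω) - s ω‖ ^ 2)) ∂P ≤
      ∫⁻ ω, η ω * ((1 + ξ ω) * ENNReal.ofReal (∑ j, (q j)⁻¹ * ‖Q j (s ω - x)‖ ^ 2) +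
        ENNReal.ofReal (∑ j, (q j)⁻¹) * ((1 + (ξ ω)⁻¹) * ξ ω ^ 2)) ∂P := by
  have hNc : Continuous N := (LipschitzWith.of_dist_le_mul (K := 1) fun s t => by
    simpa [dist_eq_norm] using hN s t).continuous
  let a : J → Ω → ℝ := fun j ω => ‖Q j (s ω - x)‖ ^ 2
  let b : J → Ω → ℝ := fun j ω => ‖Q j (s ω + l • (N (s ω) - s ω) - x)‖ ^ 2
  let r : Ω → ℝ := fun ω => κ * ‖N (s ω) - s ω‖ ^ 2
  have ha : ∀ j, Measurable[𝓐] fun ω => ENNReal.ofReal (a j ω) := fun j =>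
    ((by fun_prop : Continuous fun t : K => ‖Q j (t - x)‖ ^ 2).measurable.comp hs).ennreal_ofReal
  have hb : ∀ j, Measurable[𝓐] fun ω => ENNReal.ofReal (b j ω) := fun j =>
    ((by fun_prop : Continuous fun t : K =>
      ‖Q j (t + l • (N t - t) - x)‖ ^ 2).measurable.comp hs).ennreal_ofReal
  let η₁ : Ω → ℝ≥0∞ := fun ω => η ω * (1 + ξ ω)
  let η₂ : Ω → ℝ≥0∞ := fun ω => η ω * (1 + (ξ ω)⁻¹)
  have hη₁ : Measurable[𝓐] η₁ := hη.mul (hξ.const_add 1)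
  have hη₂ : Measurable[𝓐] η₂ := hη.mul (hξ.inv.const_add 1)
  have hη₁a : ∀ j, Measurable[𝓐] fun ω => η₁ ω * ENNReal.ofReal (a j ω) := fun j => hη₁.mul (ha j)
  have hη₁b : ∀ j, Measurable[𝓐] fun ω => η₁ ω * ENNReal.ofReal (b j ω) := fun j => hη₁.mul (hb j)
  -- The error bound stays outside the activation test, so errors may depend on the activation;
  -- independence is needed only for 𝓐-measurable quantities.
  have pt : ∀ j ω, ENNReal.ofReal (‖Q j (s' ω - x)‖ ^ 2) ≤
      (1 + ξ ω) * (if ω ∈ B j then ENNReal.ofReal (b j ω) else ENNReal.ofReal (a j ω)) +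
        (1 + (ξ ω)⁻¹) * E ω ^ 2 := by
    intro j ω
    have conv : ∀ y : K, ENNReal.ofReal (‖y‖ ^ 2) = ‖y‖ₑ ^ 2 := fun y => by
      rw [ENNReal.ofReal_pow (norm_nonneg _), ofReal_norm]
    rw [conv, map_sub, hupd]
    by_cases hω : ω ∈ B j
    · simp only [if_pos hω, b, conv]
      have h1 : ‖Q j (s ω) + l • (Q j (N (s ω) - s ω) + e j ω) - Q j x‖ₑ ≤
          ‖Q j (s ω + l • (N (s ω) - s ω) - x)‖ₑ + E ω := by
        have e1 : Q j (s ω) + l • (Q j (N (s ω) - s ω) + e j ω) - Q j x =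
            Q j (s ω + l • (N (s ω) - s ω) - x) + l • e j ω := by
          rw [map_sub (Q j) (s ω + _), map_add, map_smul, smul_add]; abel
        rw [e1]
        refine (enorm_add_le _ _).trans (add_le_add le_rfl ?_)
        refine le_trans ?_ (heE j ω)
        rw [enorm_smul]
        refine mul_le_of_le_one_left' ?_
        rw [Real.enorm_of_nonneg hl.1.le]
        exact ENNReal.ofReal_le_one.2 hl.2.le
      exact (pow_le_pow_left₀ zero_le h1 2).trans (ennreal_add_sq_le _ _ _ (hξ0 ω))
    · simp only [if_neg hω, a, conv, map_sub]
      refine le_trans ?_ le_self_add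
      exact le_mul_of_one_le_left' le_self_add
  -- The weights cancel the probabilities: q⁻¹(q b + (1 - q)a) = q⁻¹a - a + b. By `hQ`, the
  -- unweighted sums of a and b are full squared distances before and after the relaxed step.
  have pt2 : ∀ ω, ∑ j, ENNReal.ofReal (q j)⁻¹ * (ENNReal.ofReal (q j) * ENNReal.ofReal (b j ω) +
      ENNReal.ofReal (1 - q j) * ENNReal.ofReal (a j ω)) + ENNReal.ofReal (r ω) ≤
      ENNReal.ofReal (∑ j, (q j)⁻¹ * a j ω) := by
    intro ω
    have ha0 : ∀ j, 0 ≤ a j ω := fun j => sq_nonneg _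
    have hb0 : ∀ j, 0 ≤ b j ω := fun j => sq_nonneg _
    have hq1' : ∀ j, 0 ≤ 1 - q j := fun j => sub_nonneg.2 (hq1 j)
    have hqi : ∀ j, 0 ≤ (q j)⁻¹ := fun j => (inv_pos.2 (hq0 j)).le
    have hsum : ∀ j, 0 ≤ (q j)⁻¹ * (q j * b j ω + (1 - q j) * a j ω) := fun j =>
      mul_nonneg (hqi j) (add_nonneg (mul_nonneg (hq0 j).le (hb0 j)) (mul_nonneg (hq1' j) (ha0 j)))
    have e1 : ∑ j, ENNReal.ofReal (q j)⁻¹ * (ENNReal.ofReal (q j) * ENNReal.ofReal (b j ω) +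
        ENNReal.ofReal (1 - q j) * ENNReal.ofReal (a j ω)) =
        ENNReal.ofReal (∑ j, (q j)⁻¹ * (q j * b j ω + (1 - q j) * a j ω)) := by
      rw [ENNReal.ofReal_sum_of_nonneg fun j _ => hsum j]
      refine Finset.sum_congr rfl fun j _ => ?_
      rw [ENNReal.ofReal_mul (hqi j), ENNReal.ofReal_add (mul_nonneg (hq0 j).le (hb0 j))
        (mul_nonneg (hq1' j) (ha0 j)), ENNReal.ofReal_mul (hq0 j).le, ENNReal.ofReal_mul (hq1' j)]
    rw [e1, ← ENNReal.ofReal_add (Finset.sum_nonneg fun j _ => hsum j)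
      (mul_nonneg hκ0 (sq_nonneg _))]
    refine ENNReal.ofReal_le_ofReal ?_
    have e2 : ∑ j, (q j)⁻¹ * (q j * b j ω + (1 - q j) * a j ω) =
        ∑ j, (q j)⁻¹ * a j ω - ∑ j, a j ω + ∑ j, b j ω := by
      rw [← Finset.sum_sub_distrib, ← Finset.sum_add_distrib]
      refine Finset.sum_congr rfl fun j _ => ?_
      have := (hq0 j).ne'
      field_simp
      ring
    have e3 : ∑ j, a j ω = ‖s ω - x‖ ^ 2 := hQ _
    have e4 : ∑ j, b j ω = ‖s ω + l • (N (s ω) - s ω) - x‖ ^ 2 := hQ _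
    have h5 := norm_relaxed_sub_sq_le hN hx hl.1.le (s ω)
    have h6 : r ω ≤ l * (1 - l) * ‖N (s ω) - s ω‖ ^ 2 := by
      simp only [r]; gcongr
    rw [e2, e3, e4]
    linarith
  calc ∫⁻ ω, η ω * (ENNReal.ofReal (∑ j, (q j)⁻¹ * ‖Q j (s' ω - x)‖ ^ 2) +
        ENNReal.ofReal (r ω)) ∂P
      ≤ ∫⁻ ω, (∑ j, ENNReal.ofReal (q j)⁻¹ *
          ((if ω ∈ B j then η₁ ω * ENNReal.ofReal (b j ω) else η₁ ω * ENNReal.ofReal (a j ω)) +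
            η₂ ω * E ω ^ 2) + η₁ ω * ENNReal.ofReal (r ω)) ∂P := by
        refine lintegral_mono fun ω => ?_
        dsimp only [η₁, η₂]
        rw [mul_add]
        refine add_le_add ?_ ?_
        · rw [ENNReal.ofReal_sum_of_nonneg fun j _ =>
            mul_nonneg (inv_pos.2 (hq0 j)).le (sq_nonneg _), Finset.mul_sum]
          refine Finset.sum_le_sum fun j _ => ?_
          rw [ENNReal.ofReal_mul (inv_pos.2 (hq0 j)).le, mul_left_comm]
          gcongr
          refine (mul_le_mul_right (pt j ω) (η ω)).trans (le_of_eq ?_)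
          split_ifs <;> ring
        · rw [mul_assoc]
          gcongr
          exact le_mul_of_one_le_left' le_self_add
    _ = ∑ j, ENNReal.ofReal (q j)⁻¹ * (∫⁻ ω, (if ω ∈ B j then η₁ ω * ENNReal.ofReal (b j ω)
              else η₁ ω * ENNReal.ofReal (a j ω)) ∂P + ∫⁻ ω, η₂ ω * E ω ^ 2 ∂P) +
          ∫⁻ ω, η₁ ω * ENNReal.ofReal (r ω) ∂P :=
        lintegral_sum_mul_add _ _ (fun j => @Measurable.ite _ _ _ _ mΩ _ _ _ (h𝓖 _ (hB j))
          ((hη₁b j).mono h𝓐 le_rfl) ((hη₁a j).mono h𝓐 le_rfl))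
          ((hη₂.mono h𝓐 le_rfl).mul (hE.pow_const 2))
    _ ≤ ∑ j, ENNReal.ofReal (q j)⁻¹ * (∫⁻ ω, (ENNReal.ofReal (q j) *
            (η₁ ω * ENNReal.ofReal (b j ω)) + ENNReal.ofReal (1 - q j) *
              (η₁ ω * ENNReal.ofReal (a j ω))) ∂P + ∫⁻ ω, η₂ ω * ξ ω ^ 2 ∂P) +
          ∫⁻ ω, η₁ ω * ENNReal.ofReal (r ω) ∂P := by
        refine add_le_add (Finset.sum_le_sum fun j _ => mul_le_mul_right (add_le_add ?_ ?_) _) le_rfl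
        · exact (lintegral_ite_of_indep h𝓖 h𝓐 hind (hB j) (hq0 j).le (hq j) (hη₁a j) (hη₁b j)).le
        · exact hEξ _ hη₂
    _ = ∫⁻ ω, (∑ j, ENNReal.ofReal (q j)⁻¹ * ((ENNReal.ofReal (q j) *
            (η₁ ω * ENNReal.ofReal (b j ω)) + ENNReal.ofReal (1 - q j) *
              (η₁ ω * ENNReal.ofReal (a j ω))) +
            η₂ ω * ξ ω ^ 2) + η₁ ω * ENNReal.ofReal (r ω)) ∂P :=
        (lintegral_sum_mul_add _ _ (fun j => (((hη₁b j).const_mul _).add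
          ((hη₁a j).const_mul _)).mono h𝓐 le_rfl)
          ((hη₂.mul (hξ.pow_const 2)).mono h𝓐 le_rfl)).symm
    _ ≤ _ := by
        refine lintegral_mono fun ω => ?_
        have e1 : ∑ j, ENNReal.ofReal (q j)⁻¹ * ((ENNReal.ofReal (q j) *
            (η₁ ω * ENNReal.ofReal (b j ω)) + ENNReal.ofReal (1 - q j) *
              (η₁ ω * ENNReal.ofReal (a j ω))) + η₂ ω * ξ ω ^ 2) + η₁ ω * ENNReal.ofReal (r ω) =
            η₁ ω * (∑ j, ENNReal.ofReal (q j)⁻¹ *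
              (ENNReal.ofReal (q j) * ENNReal.ofReal (b j ω) +
              ENNReal.ofReal (1 - q j) * ENNReal.ofReal (a j ω)) + ENNReal.ofReal (r ω)) +
              ENNReal.ofReal (∑ j, (q j)⁻¹) * (η₂ ω * ξ ω ^ 2) := by
          rw [ENNReal.ofReal_sum_of_nonneg fun j _ => (inv_pos.2 (hq0 j)).le, mul_add,
            Finset.mul_sum, Finset.sum_mul, add_right_comm, ← Finset.sum_add_distrib]
          congr 1
          refine Finset.sum_congr rfl fun j _ => ?_
          ring
        dsimp only
        rw [e1, mul_add (η ω)]
        refine add_le_add ?_ (le_of_eq (by simp only [η₂]; ring))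
        rw [← mul_assoc]
        exact mul_le_mul_right (pt2 ω) _

end BlockIteration

/-! ### Almost sure convergence of the block iteration and control of the errors. -/

section BlockConvergence

variable {Ω : Type*} {mΩ : MeasurableSpace Ω} {P : Measure Ω} [IsProbabilityMeasure P]

/-- The measures with densities X and its conditional expectation agree on 𝓐, hence integrate every
𝓐-measurable weight equally, finite or not. -/
theorem lintegral_mul_condLExp {𝓐 : MeasurableSpace Ω} (h𝓐 : 𝓐 ≤ mΩ) {X η : Ω → ℝ≥0∞}
    (hX : Measurable[mΩ] X) (hη : Measurable[𝓐] η) :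
    ∫⁻ ω, η ω * X ω ∂P = ∫⁻ ω, η ω * condLExp 𝓐 P X ω ∂P := by
  have hC : Measurable[mΩ] (condLExp 𝓐 P X) := measurable_condLExp' _ _ _
  have htrim : (P.withDensity X).trim h𝓐 = (P.withDensity (condLExp 𝓐 P X)).trim h𝓐 := by
    refine @Measure.ext _ 𝓐 _ _ fun S hS => ?_
    rw [trim_measurableSet_eq h𝓐 hS, trim_measurableSet_eq h𝓐 hS, withDensity_apply _ (h𝓐 _ hS),
      withDensity_apply _ (h𝓐 _ hS), setLIntegral_condLExp h𝓐 P X hS]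
  have key : ∀ Y : Ω → ℝ≥0∞, Measurable[mΩ] Y →
      ∫⁻ ω, η ω * Y ω ∂P = ∫⁻ ω, η ω ∂((P.withDensity Y).trim h𝓐) := by
    intro Y hY
    rw [lintegral_trim h𝓐 hη, lintegral_withDensity_eq_lintegral_mul P hY (hη.mono h𝓐 le_rfl)]
    simp only [Pi.mul_apply, mul_comm]
  rw [key X hX, key _ hC, htrim]

/-- Almost sure weak convergence of the randomly activated block Krasnosel'skii–Mann iteration. -/
theorem ae_exists_weakTendsto_fixed {K : Type*} [NormedAddCommGroup K] [InnerProductSpace ℝ K]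
    [CompleteSpace K] [TopologicalSpace.SeparableSpace K] [MeasurableSpace K] [BorelSpace K]
    {J : Type*} [Fintype J] {Q : J → K →L[ℝ] K} (hQ : ∀ s, ∑ j, ‖Q j s‖ ^ 2 = ‖s‖ ^ 2)
    {N : K → K} (hN : ∀ s t, ‖N s - N t‖ ≤ ‖s - t‖) (hfix : ∃ x, N x = x)
    {𝓕 : Filtration ℕ mΩ} {𝓖 : ℕ → MeasurableSpace Ω} (h𝓖 : ∀ n, 𝓖 n ≤ mΩ)
    (hind : ∀ n, Indep (𝓖 n) (𝓕 n) P)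
    {B : ℕ → J → Set Ω} (hB : ∀ n j, MeasurableSet[𝓖 n] (B n j)) {q : J → ℝ} (hq0 : ∀ j, 0 < q j)
    (hq1 : ∀ j, q j ≤ 1) (hq : ∀ n j, P (B n j) = ENNReal.ofReal (q j))
    {l : ℕ → ℝ} {κ : ℝ} (hl : ∀ n, l n ∈ Set.Ioo (0 : ℝ) 1)
    (hκ0 : 0 < κ) (hκ : ∀ n, κ ≤ l n * (1 - l n)) {s : ℕ → Ω → K}
    (hs : ∀ n, Measurable[𝓕 n] (s n)) {e : ℕ → J → Ω → K} {E ξ : ℕ → Ω → ℝ≥0∞}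
    (heE : ∀ n j ω, ‖e n j ω‖ₑ ≤ E n ω) (hE : ∀ n, Measurable (E n))
    (hξ : ∀ n, Measurable[𝓕 n] (ξ n)) (hξ0 : ∀ n ω, ξ n ω ≠ 0)
    (hEξ : ∀ n (η : Ω → ℝ≥0∞), Measurable[𝓕 n] η →
      ∫⁻ ω, η ω * E n ω ^ 2 ∂P ≤ ∫⁻ ω, η ω * ξ n ω ^ 2 ∂P)
    (hξs : ∀ᵐ ω ∂P, ∑' n, ξ n ω < ∞)
    (hact : ∀ n ω j, ω ∈ B n j →
      Q j (s (n + 1) ω) = Q j (s n ω) + l n • (Q j (N (s n ω) - s n ω) + e n j ω))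
    (hinact : ∀ n ω j, ω ∉ B n j → Q j (s (n + 1) ω) = Q j (s n ω)) :
    ∀ᵐ ω ∂P, ∃ x, N x = x ∧ WeakTendsto (fun n => s n ω) x := by
  classical
  have hNc : Continuous N := (LipschitzWith.of_dist_le_mul (K := 1) fun s t => by
    simpa [dist_eq_norm] using hN s t).continuous
  have hβs : ∀ᵐ ω ∂P,
      ∑' n, ENNReal.ofReal (∑ j, (q j)⁻¹) * ((1 + (ξ n ω)⁻¹) * ξ n ω ^ 2) < ∞ := by
    filter_upwards [hξs] with ω hω
    set T := ∑' n, ξ n ω with hT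
    have hle : ∀ n, ξ n ω ≤ T := fun n => ENNReal.le_tsum n
    rw [ENNReal.tsum_mul_left]
    refine ENNReal.mul_lt_top ENNReal.ofReal_lt_top ?_
    calc ∑' n, (1 + (ξ n ω)⁻¹) * ξ n ω ^ 2 ≤ ∑' n, (T + 1) * ξ n ω := by
          refine ENNReal.tsum_le_tsum fun n => ?_
          have h1 : (1 + (ξ n ω)⁻¹) * ξ n ω ^ 2 = (ξ n ω + 1) * ξ n ω := by
            rw [add_mul, one_mul, sq, ← mul_assoc, ENNReal.inv_mul_cancel (hξ0 n ω)
              ((hle n).trans_lt hω).ne]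
            ring
          rw [h1]
          gcongr
          exact hle n
      _ = (T + 1) * T := by rw [ENNReal.tsum_mul_left]
      _ < ∞ := ENNReal.mul_lt_top (ENNReal.add_lt_top.2 ⟨hω, ENNReal.one_lt_top⟩) hω
  have hconv : ∀ x, N x = x → ∀ᵐ ω ∂P,
      (∃ c : ℝ, Tendsto (fun n => ∑ j, (q j)⁻¹ * ‖Q j (s n ω - x)‖ ^ 2) atTop (𝓝 c)) ∧
      ∑' n, ENNReal.ofReal (κ * ‖N (s n ω) - s n ω‖ ^ 2) < ∞ := by
    intro x hx
    have h := ae_tendsto_of_almost_supermartingale (P := P) (𝓕 := 𝓕)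
      (V := fun n ω => ENNReal.ofReal (∑ j, (q j)⁻¹ * ‖Q j (s n ω - x)‖ ^ 2))
      (θ := fun n ω => ENNReal.ofReal (κ * ‖N (s n ω) - s n ω‖ ^ 2))
      (α := ξ) (β := fun n ω => ENNReal.ofReal (∑ j, (q j)⁻¹) * ((1 + (ξ n ω)⁻¹) * ξ n ω ^ 2))
      (fun n => ((by fun_prop : Continuous fun t : K =>
        ∑ j, (q j)⁻¹ * ‖Q j (t - x)‖ ^ 2).measurable.comp (hs n)).ennreal_ofReal)
      (fun n => ((by fun_prop : Continuous fun t : K =>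
        κ * ‖N t - t‖ ^ 2).measurable.comp ((hs n).mono (𝓕.le n) le_rfl)).ennreal_ofReal)
      hξ (fun n => (((hξ n).inv.const_add 1).mul ((hξ n).pow_const 2)).const_mul _)
      (fun n ω => ENNReal.ofReal_ne_top) hξs hβs (fun n η hη => ?_)
    · filter_upwards [h] with ω ⟨⟨c, hc⟩, hθ⟩
      refine ⟨⟨c, hc.congr fun n => ENNReal.toReal_ofReal ?_⟩, hθ⟩
      exact Finset.sum_nonneg fun j _ => mul_nonneg (inv_pos.2 (hq0 j)).le (sq_nonneg _)
    · refine lintegral_weighted_dist_le hQ hN hx (h𝓖 n) (𝓕.le n) (hind n) (hB n) hq0 hq1 (hq n)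
        (hl n) hκ0.le (hκ n) (hs n) (heE n) (hE n) (hξ n) (hξ0 n) (hEξ n) (fun ω j => ?_) hη
      split_ifs with hω
      · exact hact n ω j hω
      · exact hinact n ω j hω
  let F : Set K := {x | N x = x}
  have : Nonempty F := Set.Nonempty.to_subtype (s := F) hfix
  -- An embedding that turns the weighted distance into a norm distance, so that
  -- `isClosed_setOf_exists_tendsto_norm_sub` applies.
  let W : K → PiLp 2 fun _ : J => K := fun t => WithLp.toLp 2 fun j => Real.sqrt (q j)⁻¹ • Q j t
  have hWc : Continuous W := by fun_prop
  have hWn : ∀ t x, ‖W t - W x‖ = Real.sqrt (∑ j, (q j)⁻¹ * ‖Q j (t - x)‖ ^ 2) := by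
    intro t x
    rw [PiLp.norm_eq_of_L2]
    congr 1
    refine Finset.sum_congr rfl fun j _ => ?_
    have e1 : (W t - W x) j = Real.sqrt (q j)⁻¹ • Q j (t - x) := by
      simp [W, smul_sub]
    rw [e1, norm_smul, mul_pow, Real.norm_eq_abs, sq_abs, Real.sq_sqrt (inv_pos.2 (hq0 j)).le]
  -- The exceptional null set depends on the fixed point; a dense sequence in the fixed point set
  -- leaves a single one.
  have hall := ae_all_iff.2 fun k : ℕ =>
    hconv (TopologicalSpace.denseSeq F k) (TopologicalSpace.denseSeq F k).2
  filter_upwards [hall] with ω hω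
  have hr : Tendsto (fun n => ‖N (s n ω) - s n ω‖) atTop (𝓝 0) := by
    have h1 := ENNReal.tendsto_atTop_zero_of_tsum_ne_top (hω 0).2.ne
    have h2 := (ENNReal.tendsto_toReal ENNReal.zero_ne_top).comp h1
    have h3 : Tendsto (fun n => κ * ‖N (s n ω) - s n ω‖ ^ 2) atTop (𝓝 0) :=
      h2.congr fun n => ENNReal.toReal_ofReal (mul_nonneg hκ0.le (sq_nonneg _))
    have h4 := ((h3.const_mul κ⁻¹).sqrt)
    rw [mul_zero, Real.sqrt_zero] at h4
    refine h4.congr fun n => ?_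
    rw [← mul_assoc, inv_mul_cancel₀ hκ0.ne', one_mul, Real.sqrt_sq (norm_nonneg _)]
  have hu : ∀ x, N x = x →
      ∃ c, Tendsto (fun n => ∑ j, (q j)⁻¹ * ‖Q j (s n ω - x)‖ ^ 2) atTop (𝓝 c) := by
    intro x hx
    have hx' : ∃ c : ℝ, Tendsto (fun n => ‖W (s n ω) - W ((⟨x, hx⟩ : F) : K)‖) atTop (𝓝 c) := by
      refine (TopologicalSpace.denseRange_denseSeq F).induction_on
        (p := fun y : F => ∃ c : ℝ, Tendsto (fun n => ‖W (s n ω) - W y‖) atTop (𝓝 c))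
        (⟨x, hx⟩ : F) ?_ fun k => ?_
      · exact (isClosed_setOf_exists_tendsto_norm_sub fun n => W (s n ω)).preimage
          (hWc.comp continuous_subtype_val)
      · obtain ⟨c, hc⟩ := (hω k).1
        exact ⟨_, hc.sqrt.congr fun n => (hWn _ _).symm⟩
    obtain ⟨c, hc⟩ := hx'
    refine ⟨c ^ 2, (hc.pow 2).congr fun n => ?_⟩
    rw [hWn, Real.sq_sqrt]
    exact Finset.sum_nonneg fun j _ => mul_nonneg (inv_pos.2 (hq0 j)).le (sq_nonneg _)
  obtain ⟨x, hx, hlim⟩ := exists_weak_limit_fixed hQ (fun j => inv_pos.2 (hq0 j)) hN hfix hu hr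
  exact ⟨x, hx, weakTendsto_iff_inner.2 hlim⟩

theorem ennreal_sum_four_sq_le (a b c d : ℝ≥0∞) :
    (a + b + c + d) ^ 2 ≤ 4 * (a ^ 2 + b ^ 2 + c ^ 2 + d ^ 2) := by
  have h : ∀ u v : ℝ≥0∞, (u + v) ^ 2 ≤ 2 * (u ^ 2 + v ^ 2) := fun u v =>
    (ennreal_add_sq_le u v 1 one_ne_zero).trans_eq (by rw [inv_one, one_add_one_eq_two]; ring)
  calc (a + b + c + d) ^ 2 = ((a + b) + (c + d)) ^ 2 := by rw [add_assoc]
    _ ≤ 2 * ((a + b) ^ 2 + (c + d) ^ 2) := h _ _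
    _ ≤ 2 * (2 * (a ^ 2 + b ^ 2) + 2 * (c ^ 2 + d ^ 2)) := by gcongr <;> exact h _ _
    _ = _ := by ring

/-- The error sequences admit a common summable predictable bound in conditional mean square. -/
theorem exists_summable_error_bound {A B : Type*} [NormedAddCommGroup A] [NormedAddCommGroup B]
    [MeasurableSpace A] [BorelSpace A] [MeasurableSpace B] [BorelSpace B]
    {𝓕 : Filtration ℕ mΩ} {a c : ℕ → Ω → A} {b d : ℕ → Ω → B}
    (ha : ∀ n, Measurable (a n)) (hb : ∀ n, Measurable (b n))
    (hc : ∀ n, Measurable (c n)) (hd : ∀ n, Measurable (d n))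
    (hasum : SummableErrors P 𝓕 a) (hbsum : SummableErrors P 𝓕 b)
    (hcsum : SummableErrors P 𝓕 c) (hdsum : SummableErrors P 𝓕 d) (C : NNReal) :
    ∃ ξ : ℕ → Ω → ℝ≥0∞, (∀ n, Measurable[𝓕 n] (ξ n)) ∧ (∀ n ω, ξ n ω ≠ 0) ∧
      (∀ n (η : Ω → ℝ≥0∞), Measurable[𝓕 n] η →
        ∫⁻ ω, η ω * (C * (‖a n ω‖ₑ + ‖b n ω‖ₑ + ‖c n ω‖ₑ + ‖d n ω‖ₑ)) ^ 2 ∂P ≤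
          ∫⁻ ω, η ω * ξ n ω ^ 2 ∂P) ∧
      ∀ᵐ ω ∂P, ∑' n, ξ n ω < ∞ := by
  let α : ℕ → Ω → ℝ≥0∞ := fun n => condLExp (𝓕 n) P fun ω' => ‖a n ω'‖ₑ ^ 2
  let β : ℕ → Ω → ℝ≥0∞ := fun n => condLExp (𝓕 n) P fun ω' => ‖b n ω'‖ₑ ^ 2
  let χ : ℕ → Ω → ℝ≥0∞ := fun n => condLExp (𝓕 n) P fun ω' => ‖c n ω'‖ₑ ^ 2
  let δ : ℕ → Ω → ℝ≥0∞ := fun n => condLExp (𝓕 n) P fun ω' => ‖d n ω'‖ₑ ^ 2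
  have hα : ∀ n, Measurable[𝓕 n] (α n) := fun n => measurable_condLExp _ _ _
  have hβ : ∀ n, Measurable[𝓕 n] (β n) := fun n => measurable_condLExp _ _ _
  have hχ : ∀ n, Measurable[𝓕 n] (χ n) := fun n => measurable_condLExp _ _ _
  have hδ : ∀ n, Measurable[𝓕 n] (δ n) := fun n => measurable_condLExp _ _ _
  have hsq : ∀ t : ℝ≥0∞, (t ^ (1 / 2 : ℝ)) ^ 2 = t := fun t => by
    rw [← ENNReal.rpow_natCast, ← ENNReal.rpow_mul]; norm_num
  let R : ℕ → Ω → ℝ≥0∞ := fun n ω =>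
    α n ω ^ (1 / 2 : ℝ) + β n ω ^ (1 / 2 : ℝ) + χ n ω ^ (1 / 2 : ℝ) + δ n ω ^ (1 / 2 : ℝ)
  -- The factor 2C is the square root of the 4C² from squaring four terms; the summable 2⁻ⁿ keeps ξ
  -- nonzero, as needed to use ξ⁻¹.
  refine ⟨fun n ω => 2 * C * R n ω + 2⁻¹ ^ n, fun n => ?_, fun n ω => ?_, fun n η hη => ?_, ?_⟩
  · exact ((((((hα n).pow_const _).add ((hβ n).pow_const _)).add ((hχ n).pow_const _)).add
      ((hδ n).pow_const _)).const_mul _).add_const _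
  · simp
  · have hpull : ∀ {X : Ω → ℝ≥0∞}, Measurable X →
        ∫⁻ ω, η ω * X ω ∂P = ∫⁻ ω, η ω * condLExp (𝓕 n) P X ω ∂P := fun hX =>
      lintegral_mul_condLExp (𝓕.le n) hX hη
    have hη' := hη.mono (𝓕.le n) le_rfl
    have hsplit : ∀ X₁ X₂ X₃ X₄ : Ω → ℝ≥0∞, Measurable X₁ → Measurable X₂ → Measurable X₃ →
        ∫⁻ ω, η ω * (4 * C ^ 2 * (X₁ ω + X₂ ω + X₃ ω + X₄ ω)) ∂P =
        4 * C ^ 2 * (∫⁻ ω, η ω * X₁ ω ∂P + ∫⁻ ω, η ω * X₂ ω ∂P + ∫⁻ ω, η ω * X₃ ω ∂P +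
          ∫⁻ ω, η ω * X₄ ω ∂P) := by
      intro X₁ X₂ X₃ X₄ h₁ h₂ h₃
      rw [← lintegral_add_left (hη'.fun_mul h₁),
        ← lintegral_add_left ((hη'.fun_mul h₁).fun_add (hη'.fun_mul h₂)),
        ← lintegral_add_left
          (((hη'.fun_mul h₁).fun_add (hη'.fun_mul h₂)).fun_add (hη'.fun_mul h₃)),
        ← lintegral_const_mul' _ _ (by finiteness)]
      refine lintegral_congr fun ω => ?_
      ring
    calc ∫⁻ ω, η ω * (C * (‖a n ω‖ₑ + ‖b n ω‖ₑ + ‖c n ω‖ₑ + ‖d n ω‖ₑ)) ^ 2 ∂P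
        ≤ ∫⁻ ω, η ω * (4 * C ^ 2 *
            (‖a n ω‖ₑ ^ 2 + ‖b n ω‖ₑ ^ 2 + ‖c n ω‖ₑ ^ 2 + ‖d n ω‖ₑ ^ 2)) ∂P := by
          refine lintegral_mono fun ω => mul_le_mul_right ?_ _
          rw [mul_pow, mul_comm (4 : ℝ≥0∞), mul_assoc]
          exact mul_le_mul_right (ennreal_sum_four_sq_le _ _ _ _) _
      _ = ∫⁻ ω, η ω * (4 * C ^ 2 * (α n ω + β n ω + χ n ω + δ n ω)) ∂P := by
          rw [hsplit _ _ _ _ ((ha n).enorm.pow_const 2) ((hb n).enorm.pow_const 2)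
            ((hc n).enorm.pow_const 2), hpull ((ha n).enorm.pow_const 2),
            hpull ((hb n).enorm.pow_const 2), hpull ((hc n).enorm.pow_const 2),
            hpull ((hd n).enorm.pow_const 2)]
          exact (hsplit _ _ _ _ ((hα n).mono (𝓕.le n) le_rfl) ((hβ n).mono (𝓕.le n) le_rfl)
            ((hχ n).mono (𝓕.le n) le_rfl)).symm
      _ ≤ _ := by
          refine lintegral_mono fun ω => mul_le_mul_right ?_ _
          have h1 : α n ω + β n ω + χ n ω + δ n ω ≤ R n ω ^ 2 := by
            have hadd : ∀ u v : ℝ≥0∞, u ^ 2 + v ^ 2 ≤ (u + v) ^ 2 := fun u v => by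
              rw [add_sq]; gcongr; exact le_self_add
            rw [← hsq (α n ω), ← hsq (β n ω), ← hsq (χ n ω), ← hsq (δ n ω)]
            exact (add_le_add ((add_le_add (hadd _ _) le_rfl).trans (hadd _ _)) le_rfl).trans
              (hadd _ _)
          calc 4 * (C : ℝ≥0∞) ^ 2 * (α n ω + β n ω + χ n ω + δ n ω)
              ≤ 4 * (C : ℝ≥0∞) ^ 2 * R n ω ^ 2 := by gcongr
            _ = (2 * C * R n ω) ^ 2 := by ring
            _ ≤ _ := pow_le_pow_left₀ zero_le le_self_add 2
  · filter_upwards [hasum, hbsum, hcsum, hdsum] with ω h1 h2 h3 h4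
    rw [ENNReal.tsum_add, ENNReal.tsum_mul_left]
    have hR : ∑' n, R n ω < ∞ := by
      simp only [R, ENNReal.tsum_add]
      exact ENNReal.add_lt_top.2 ⟨ENNReal.add_lt_top.2 ⟨ENNReal.add_lt_top.2 ⟨h1, h2⟩, h3⟩, h4⟩
    have hgeo : ∑' n : ℕ, (2⁻¹ : ℝ≥0∞) ^ n < ∞ := by
      rw [ENNReal.tsum_geometric, ENNReal.one_sub_inv_two, inv_inv]; exact ENNReal.ofNat_lt_top
    exact ENNReal.add_lt_top.2 ⟨ENNReal.mul_lt_top (by finiteness) hR, hgeo⟩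

end BlockConvergence

noncomputable section

/-! ### The reflected operator on H ⊕ G and its fixed points. -/

section DouglasRachford

/-- The Hilbert direct sum `H ⊕ G`. -/
abbrev BlockSpace {m p : ℕ} (H : Fin m → Type*) (G : Fin p → Type*) : Type _ :=
  WithLp 2 (PiLp 2 H × PiLp 2 G)

variable {m p : ℕ} {H : Fin m → Type*} {G : Fin p → Type*}
  [∀ i, NormedAddCommGroup (H i)] [∀ i, InnerProductSpace ℝ (H i)]
  [∀ k, NormedAddCommGroup (G k)] [∀ k, InnerProductSpace ℝ (G k)]

variable (H G) in
/-- The embedding of `H i` into `H ⊕ G`. -/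
def primalBlock (i : Fin m) : H i →L[ℝ] BlockSpace H G :=
  (WithLp.prodContinuousLinearEquiv 2 ℝ (PiLp 2 H) (PiLp 2 G)).symm.toContinuousLinearMap ∘L
    ContinuousLinearMap.inl ℝ (PiLp 2 H) (PiLp 2 G) ∘L
    (PiLp.continuousLinearEquiv 2 ℝ H).symm.toContinuousLinearMap ∘L
    ContinuousLinearMap.single ℝ H i

variable (H G) in
/-- The embedding of `G k` into `H ⊕ G`. -/
def dualBlock (k : Fin p) : G k →L[ℝ] BlockSpace H G :=
  (WithLp.prodContinuousLinearEquiv 2 ℝ (PiLp 2 H) (PiLp 2 G)).symm.toContinuousLinearMap ∘L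
    ContinuousLinearMap.inr ℝ (PiLp 2 H) (PiLp 2 G) ∘L
    (PiLp.continuousLinearEquiv 2 ℝ G).symm.toContinuousLinearMap ∘L
    ContinuousLinearMap.single ℝ G k

theorem norm_primalBlock (i : Fin m) (h : H i) : ‖primalBlock H G i h‖ = ‖h‖ := by
  have e : primalBlock H G i h = WithLp.toLp 2 (PiLp.single 2 i h, 0) := rfl
  rw [e, WithLp.prod_norm_eq_of_L2]
  simp

theorem norm_dualBlock (k : Fin p) (h : G k) : ‖dualBlock H G k h‖ = ‖h‖ := by
  have e : dualBlock H G k h = WithLp.toLp 2 (0, PiLp.single 2 k h) := rfl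
  rw [e, WithLp.prod_norm_eq_of_L2]
  simp

variable (H G) in
/-- The coordinate projections of `H ⊕ G`, seen as operators on `H ⊕ G`. -/
def blockProj : Fin m ⊕ Fin p → BlockSpace H G →L[ℝ] BlockSpace H G :=
  Sum.elim
    (fun i => primalBlock H G i ∘L PiLp.proj 2 H i ∘L WithLp.fstL 2 ℝ (PiLp 2 H) (PiLp 2 G))
    (fun k => dualBlock H G k ∘L PiLp.proj 2 G k ∘L WithLp.sndL 2 ℝ (PiLp 2 H) (PiLp 2 G))

theorem blockProj_inl (i : Fin m) (s : BlockSpace H G) :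
    blockProj H G (Sum.inl i) s = primalBlock H G i (s.fst i) := rfl

theorem blockProj_inr (k : Fin p) (s : BlockSpace H G) :
    blockProj H G (Sum.inr k) s = dualBlock H G k (s.snd k) := rfl

theorem blockSpace_norm_sq {m p : ℕ} {H : Fin m → Type*} {G : Fin p → Type*}
    [∀ i, NormedAddCommGroup (H i)] [∀ k, NormedAddCommGroup (G k)] (s : BlockSpace H G) :
    ‖s‖ ^ 2 = ∑ i, ‖s.fst i‖ ^ 2 + ∑ k, ‖s.snd k‖ ^ 2 := by
  rw [WithLp.prod_norm_sq_eq_of_L2, PiLp.norm_sq_eq_of_L2, PiLp.norm_sq_eq_of_L2]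

theorem blockSpace_inner (s t : BlockSpace H G) :
    ⟪s, t⟫_ℝ = ∑ i, ⟪s.fst i, t.fst i⟫_ℝ + ∑ k, ⟪s.snd k, t.snd k⟫_ℝ := by
  rw [WithLp.prod_inner_apply, PiLp.inner_apply, PiLp.inner_apply]
  rfl

theorem sum_norm_blockProj_sq (s : BlockSpace H G) :
    ∑ j, ‖blockProj H G j s‖ ^ 2 = ‖s‖ ^ 2 := by
  rw [Fintype.sum_sum_type, blockSpace_norm_sq]
  simp only [blockProj_inl, blockProj_inr, norm_primalBlock, norm_dualBlock]

variable [∀ i, CompleteSpace (H i)] [∀ k, CompleteSpace (G k)]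

/-- The composition of the reflected proximity operators of `γ f_i`, `γ g_k` with the reflector
of the subspace `V`. -/
def reflectedOperator (f : ∀ i, H i → EReal) (g : ∀ k, G k → EReal) (L : ∀ k i, H i →L[ℝ] G k)
    (γ : ℝ) (s : BlockSpace H G) : BlockSpace H G :=
  WithLp.toLp 2
    (WithLp.toLp 2 fun i => (2 : ℝ) • prox (fun t => (γ : EReal) * f i t)
        (((graphSubspace L).reflection s).fst i) - ((graphSubspace L).reflection s).fst i,
      WithLp.toLp 2 fun k => (2 : ℝ) • prox (fun t => (γ : EReal) * g k t)
        (((graphSubspace L).reflection s).snd k) - ((graphSubspace L).reflection s).snd k)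

variable {f : ∀ i, H i → EReal} {g : ∀ k, G k → EReal} {L : ∀ k i, H i →L[ℝ] G k} {γ : ℝ}

theorem reflection_fst (s : BlockSpace H G) (i : Fin m) :
    ((graphSubspace L).reflection s).fst i =
      (2 : ℝ) • ((graphSubspace L).starProjection s).fst i - s.fst i := by
  rw [Submodule.reflection_apply, two_smul, two_smul]
  rfl

theorem reflection_snd (s : BlockSpace H G) (k : Fin p) :
    ((graphSubspace L).reflection s).snd k =
      (2 : ℝ) • ((graphSubspace L).starProjection s).snd k - s.snd k := by
  rw [Submodule.reflection_apply, two_smul, two_smul]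
  rfl

/-- Reflection through V is an isometry, and the reflected proximity operators are nonexpansive
block by block. -/
theorem norm_reflectedOperator_sub_le (hf : ∀ i, GammaZero (fun t => (γ : EReal) * f i t))
    (hg : ∀ k, GammaZero (fun t => (γ : EReal) * g k t))
    (hfs : ∀ i, ∃ x u, u ∈ subdiff (fun t => (γ : EReal) * f i t) x)
    (hgs : ∀ k, ∃ x u, u ∈ subdiff (fun t => (γ : EReal) * g k t) x) (s t : BlockSpace H G) :
    ‖reflectedOperator f g L γ s - reflectedOperator f g L γ t‖ ≤ ‖s - t‖ := by
  rw [← (graphSubspace L).reflection.norm_map (s - t), map_sub]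
  refine le_of_sq_le_sq ?_ (norm_nonneg _)
  rw [blockSpace_norm_sq, blockSpace_norm_sq]
  refine add_le_add (Finset.sum_le_sum fun i _ => ?_) (Finset.sum_le_sum fun k _ => ?_)
  · exact pow_le_pow_left₀ (norm_nonneg _) ((hf i).norm_reflected_prox_sub_le (hfs i) _ _) 2
  · exact pow_le_pow_left₀ (norm_nonneg _) ((hg k).norm_reflected_prox_sub_le (hgs k) _ _) 2

theorem inner_sub_starProjection_eq_zero (s : BlockSpace H G) (x : ∀ i, H i) :
    ∑ i, ⟪s.fst i - ((graphSubspace L).starProjection s).fst i, x i⟫_ℝ +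
      ∑ k, ⟪s.snd k - ((graphSubspace L).starProjection s).snd k, ∑ i, L k i (x i)⟫_ℝ = 0 := by
  let w : BlockSpace H G :=
    WithLp.toLp 2 (WithLp.toLp 2 x, WithLp.toLp 2 fun k => ∑ i, L k i (x i))
  have hw : w ∈ graphSubspace L := fun k => rfl
  have h := Submodule.starProjection_inner_eq_zero (K := graphSubspace L) s w hw
  rw [blockSpace_inner] at h
  exact h

/-- The residual s - P_V s is orthogonal to V. Testing it on (h, L h) with h supported in block i
isolates the i-th equation of V^⊥. -/
theorem adjoint_sub_starProjection (s : BlockSpace H G) (i : Fin m) :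
    s.fst i - ((graphSubspace L).starProjection s).fst i +
      ∑ k, ContinuousLinearMap.adjoint (L k i)
        (s.snd k - ((graphSubspace L).starProjection s).snd k) = 0 := by
  refine ext_inner_right ℝ fun h => ?_
  have h0 := inner_sub_starProjection_eq_zero (L := L) s (Pi.single i h)
  have e1 : ∀ k, ∑ j, L k j (Pi.single (M := H) i h j) = L k i h := fun k => by
    rw [Finset.sum_eq_single i]
    · simp
    · intro j _ hj
      simp [Pi.single_eq_of_ne hj]
    · simp
  rw [Finset.sum_eq_single i (fun j _ hj => by simp [Pi.single_eq_of_ne hj]) (by simp)] at h0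
  simp only [e1, Pi.single_eq_same] at h0
  rw [inner_add_left, sum_inner, inner_zero_left]
  simp only [ContinuousLinearMap.adjoint_inner_left]
  exact h0

/-- Fixed points of the reflected operator give primal and dual solutions. -/
theorem mem_solutions_of_fixed (hγ : 0 < γ) (hf : ∀ i, GammaZero (f i)) (hg : ∀ k, GammaZero (g k))
    (hfs : ∀ i, ∃ x u, u ∈ subdiff (fun t => (γ : EReal) * f i t) x)
    (hgs : ∀ k, ∃ x u, u ∈ subdiff (fun t => (γ : EReal) * g k t) x) {s : BlockSpace H G}
    (hs : reflectedOperator f g L γ s = s) :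
    ((graphSubspace L).starProjection s).fst ∈ primalSolutions f g L ∧
      γ⁻¹ • (((graphSubspace L).starProjection s).snd - s.snd) ∈ dualSolutions f g L := by
  -- With r = 2q - s, the fixed point equation 2 prox r - r = s forces prox r = q, so r - q = q - s
  -- lies in γ∂f_i(q).
  have hfi : ∀ i, γ⁻¹ • (((graphSubspace L).starProjection s).fst i - s.fst i) ∈
      subdiff (f i) (((graphSubspace L).starProjection s).fst i) := by
    intro i
    have e : (2 : ℝ) • prox (fun t => (γ : EReal) * f i t) (((graphSubspace L).reflection s).fst i) -
        ((graphSubspace L).reflection s).fst i = s.fst i := congrArg (fun q => q.fst i) hs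
    rw [reflection_fst] at e
    have hp : prox (fun t => (γ : EReal) * f i t)
        ((2 : ℝ) • ((graphSubspace L).starProjection s).fst i - s.fst i) =
        ((graphSubspace L).starProjection s).fst i := by
      refine smul_right_injective (H i) (two_ne_zero (α := ℝ)) ?_
      dsimp only
      rw [sub_eq_iff_eq_add.1 e]
      abel
    have h := ((hf i).const_mul hγ).sub_prox_mem_subdiff (hfs i)
      ((2 : ℝ) • ((graphSubspace L).starProjection s).fst i - s.fst i)
    rw [hp, (hf i).mem_subdiff_const_mul_iff hγ] at h
    convert h using 2
    module
  have hgk : ∀ k, γ⁻¹ • (((graphSubspace L).starProjection s).snd k - s.snd k) ∈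
      subdiff (g k) (((graphSubspace L).starProjection s).snd k) := by
    intro k
    have e : (2 : ℝ) • prox (fun t => (γ : EReal) * g k t) (((graphSubspace L).reflection s).snd k) -
        ((graphSubspace L).reflection s).snd k = s.snd k := congrArg (fun q => q.snd k) hs
    rw [reflection_snd] at e
    have hp : prox (fun t => (γ : EReal) * g k t)
        ((2 : ℝ) • ((graphSubspace L).starProjection s).snd k - s.snd k) =
        ((graphSubspace L).starProjection s).snd k := by
      refine smul_right_injective (G k) (two_ne_zero (α := ℝ)) ?_
      dsimp only
      rw [sub_eq_iff_eq_add.1 e]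
      abel
    have h := ((hg k).const_mul hγ).sub_prox_mem_subdiff (hgs k)
      ((2 : ℝ) • ((graphSubspace L).starProjection s).snd k - s.snd k)
    rw [hp, (hg k).mem_subdiff_const_mul_iff hγ] at h
    convert h using 2
    module
  have hmem : ∀ k, ((graphSubspace L).starProjection s).snd k =
      ∑ i, L k i (((graphSubspace L).starProjection s).fst i) :=
    (graphSubspace L).starProjection_apply_mem s
  refine mem_solutions_of_kkt hf hg (fun k => ?_) fun i => ?_
  · rw [← hmem k]; exact hgk k
  · convert hfi i using 1
    have h := adjoint_sub_starProjection (L := L) s i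
    have e : ∀ k, ContinuousLinearMap.adjoint (L k i)
        ((γ⁻¹ • (((graphSubspace L).starProjection s).snd - s.snd)) k) =
        -(γ⁻¹ • ContinuousLinearMap.adjoint (L k i)
          (s.snd k - ((graphSubspace L).starProjection s).snd k)) := by
      intro k
      rw [← map_smul, ← map_neg, ← smul_neg, neg_sub]
      rfl
    simp only [e, Finset.sum_neg_distrib, neg_neg, ← Finset.smul_sum]
    rw [eq_neg_of_add_eq_zero_right h, neg_sub]

/-- A primal-dual Karush–Kuhn–Tucker pair yields a fixed point of the reflected operator. -/
theorem exists_fixed_of_kkt (hγ : 0 < γ) (hf : ∀ i, GammaZero (f i)) (hg : ∀ k, GammaZero (g k))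
    {x : PiLp 2 H} {v : PiLp 2 G} (hv : ∀ k, v k ∈ subdiff (g k) (∑ j, L k j (x j)))
    (hu : ∀ i, -∑ k, ContinuousLinearMap.adjoint (L k i) (v k) ∈ subdiff (f i) (x i)) :
    ∃ s, reflectedOperator f g L γ s = s := by
  let u : ∀ i, H i := fun i => -∑ k, ContinuousLinearMap.adjoint (L k i) (v k)
  let q : BlockSpace H G := WithLp.toLp 2 (x, WithLp.toLp 2 fun k => ∑ j, L k j (x j))
  -- Since (u, v) is orthogonal to V, P_V s = q and the reflection of s is q + γ(u, v). Its
  -- blockwise proximal point is q by the subgradient conditions, so reflecting again returns s.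
  let s : BlockSpace H G := q - γ • WithLp.toLp 2 (WithLp.toLp 2 u, v)
  have hq : q ∈ graphSubspace L := fun k => rfl
  have hP : (graphSubspace L).starProjection s = q := by
    refine Submodule.eq_starProjection_of_mem_of_inner_eq_zero hq fun w hw => ?_
    have e : s - q = -(γ • WithLp.toLp 2 (WithLp.toLp 2 u, v)) := by simp only [s]; abel
    have hw' : ∀ k, w.snd k = ∑ i, L k i (w.fst i) := hw
    have h0 : ⟪(WithLp.toLp 2 (WithLp.toLp 2 u, v) : BlockSpace H G), w⟫_ℝ = 0 := by
      rw [real_inner_comm, blockSpace_inner]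
      simp only [hw']
      have h1 := sum_inner_adjoint (L := L) (fun i => w.fst i) v
      change ∑ i, ⟪w.fst i, u i⟫_ℝ + ∑ k, ⟪∑ i, L k i (w.fst i), v k⟫_ℝ = 0
      linarith
    rw [e, inner_neg_left, inner_smul_left, h0, mul_zero, neg_zero]
  refine ⟨s, ?_⟩
  have e1 : ∀ i, (2 : ℝ) • prox (fun t => (γ : EReal) * f i t)
      (((graphSubspace L).reflection s).fst i) - ((graphSubspace L).reflection s).fst i =
      s.fst i := by
    intro i
    rw [reflection_fst, hP]
    have hs : s.fst i = x i - γ • u i := rfl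
    have hqi : q.fst i = x i := rfl
    rw [hs, hqi, ((hf i).const_mul hγ).prox_eq_of_mem_subdiff (q := x i)]
    · abel
    · rw [(hf i).mem_subdiff_const_mul_iff hγ]
      have e : (2 : ℝ) • x i - (x i - γ • u i) - x i = γ • u i := by module
      rw [e, smul_smul, inv_mul_cancel₀ hγ.ne', one_smul]
      exact hu i
  have e2 : ∀ k, (2 : ℝ) • prox (fun t => (γ : EReal) * g k t)
      (((graphSubspace L).reflection s).snd k) - ((graphSubspace L).reflection s).snd k =
      s.snd k := by
    intro k
    rw [reflection_snd, hP]
    have hs : s.snd k = (∑ j, L k j (x j)) - γ • v k := rfl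
    have hqi : q.snd k = ∑ j, L k j (x j) := rfl
    rw [hs, hqi, ((hg k).const_mul hγ).prox_eq_of_mem_subdiff (q := ∑ j, L k j (x j))]
    · abel
    · rw [(hg k).mem_subdiff_const_mul_iff hγ]
      have e : (2 : ℝ) • (∑ j, L k j (x j)) - ((∑ j, L k j (x j)) - γ • v k) -
          (∑ j, L k j (x j)) = γ • v k := by module
      rw [e, smul_smul, inv_mul_cancel₀ hγ.ne', one_smul]
      exact hv k
  have e3 : (reflectedOperator f g L γ s).fst = s.fst := PiLp.ext e1
  have e4 : (reflectedOperator f g L γ s).snd = s.snd := PiLp.ext e2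
  exact WithLp.ofLp_injective 2 (Prod.ext e3 e4)

end DouglasRachford

end

/-! ### Weak convergence by blocks and under intermittent refreshing. -/

section WeakBlocks

theorem WeakTendsto.map {E F : Type*} [NormedAddCommGroup E] [InnerProductSpace ℝ E]
    [NormedAddCommGroup F] [InnerProductSpace ℝ F] {u : ℕ → E} {l : E} (h : WeakTendsto u l)
    (T : E →L[ℝ] F) : WeakTendsto (fun n => T (u n)) (T l) :=
  ((WeakSpace.map T).continuous.tendsto _).comp h

theorem weakTendsto_piLp {ι : Type*} [Fintype ι] {E : ι → Type*} [∀ i, NormedAddCommGroup (E i)]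
    [∀ i, InnerProductSpace ℝ (E i)] [∀ i, CompleteSpace (E i)] {u : ℕ → PiLp 2 E} {l : PiLp 2 E}
    (h : ∀ i (v : E i), Tendsto (fun n => ⟪v, u n i⟫_ℝ) atTop (𝓝 ⟪v, l i⟫_ℝ)) :
    WeakTendsto u l := by
  refine weakTendsto_iff_inner.2 fun v => ?_
  simp only [PiLp.inner_apply]
  exact tendsto_finsetSum _ fun i _ => h i (v i)

/-- A sequence which is refreshed infinitely often from a convergent sequence, and otherwise held,
converges to the same limit. -/
theorem tendsto_of_frequently_refreshed {ζ r : ℕ → ℝ} {l : ℝ} {A : ℕ → Prop}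
    (hA : ∃ᶠ n in atTop, A n) (h1 : ∀ n, A n → ζ (n + 1) = r n)
    (h2 : ∀ n, ¬A n → ζ (n + 1) = ζ n) (hr : Tendsto r atTop (𝓝 l)) :
    Tendsto ζ atTop (𝓝 l) := by
  rw [tendsto_def] at hr ⊢
  intro U hU
  obtain ⟨n₀, hn₀⟩ := mem_atTop_sets.1 (hr U hU)
  -- From n₁ + 1 on, every held value is some r k with k ≥ n₀.
  obtain ⟨n₁, hn₁, hA₁⟩ := frequently_atTop.1 hA n₀
  refine mem_atTop_sets.2 ⟨n₁ + 1, fun n hn => ?_⟩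
  change ζ n ∈ U
  induction n, hn using Nat.le_induction with
  | base => rw [h1 _ hA₁]; exact hn₀ _ hn₁
  | succ n hn ih =>
    by_cases hAn : A n
    · rw [h1 _ hAn]; exact hn₀ _ (by omega)
    · rw [h2 _ hAn]; exact ih

end WeakBlocks

/-! ### The errors in the block iteration. -/

section Errors

theorem enorm_le_const_mul {A B C D E : Type*} [SeminormedAddCommGroup A]
    [SeminormedAddCommGroup B] [SeminormedAddCommGroup C] [SeminormedAddCommGroup D]
    [SeminormedAddCommGroup E] {a : A} {b : B} {c : C} {d : D} {t : E} {r : NNReal}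
    (h : ‖t‖ ≤ r * (‖a‖ + ‖b‖ + ‖c‖ + ‖d‖)) :
    ‖t‖ₑ ≤ r * (‖a‖ₑ + ‖b‖ₑ + ‖c‖ₑ + ‖d‖ₑ) := by
  simp only [enorm_eq_nnnorm]
  exact_mod_cast h

variable {E : Type*} [NormedAddCommGroup E] [InnerProductSpace ℝ E] [CompleteSpace E]

/-- The error induced on a reflected proximal step by perturbing the projection and the prox. -/
theorem GammaZero.norm_step_error_le {f : E → EReal} (hf : GammaZero f)
    (hs : ∃ x u, u ∈ subdiff f x) (q x a c : E) :
    ‖(2 : ℝ) • (prox f ((2 : ℝ) • (q + c) - x) - prox f ((2 : ℝ) • q - x)) + (2 : ℝ) • a -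
      (2 : ℝ) • c‖ ≤ 6 * (‖a‖ + ‖c‖) := by
  have h := hf.norm_prox_sub_le hs ((2 : ℝ) • (q + c) - x) ((2 : ℝ) • q - x)
  have e : (2 : ℝ) • (q + c) - x - ((2 : ℝ) • q - x) = (2 : ℝ) • c := by module
  rw [e, norm_smul, Real.norm_ofNat] at h
  refine (norm_sub_le _ _).trans ((add_le_add_left (norm_add_le _ _) _).trans ?_)
  rw [norm_smul, norm_smul, norm_smul, Real.norm_ofNat]
  -- Shifting the argument by 2c costs 4‖c‖ after doubling; adding 2‖a‖ + 2‖c‖ stays below 6(‖a‖ +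
  -- ‖c‖).
  linarith [norm_nonneg a]

/-- Activation refreshes z' to q + c, and doubling the increment explains the relaxation μ/2. The
point r₀ cancels; it will be the exact proximal point, so the last group of terms is the error. -/
theorem active_step_eq {E : Type*} [NormedAddCommGroup E] [InnerProductSpace ℝ E] {x x' z z' q a c r₀ : E} {R : E → E} {μ : ℝ}
    (hz : z' = z + (1 : ℝ) • (q + c - z))
    (hx : x' = x + (1 * μ) • (R ((2 : ℝ) • z' - x) + a - z')) :
    x' = x + (μ / 2) • (((2 : ℝ) • r₀ - ((2 : ℝ) • q - x)) - x +
      ((2 : ℝ) • (R ((2 : ℝ) • (q + c) - x) - r₀) + (2 : ℝ) • a - (2 : ℝ) • c)) := by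
  have hz' : z' = q + c := by rw [hz, one_smul]; abel
  rw [hx, hz']
  module

end Errors

/-! ### Recurrence of the activations. -/

section Activation

variable {m p : ℕ}

theorem coeff_of_eq_one {e : Activation m p} {j : Fin m ⊕ Fin p} (h : e.1 j = 1) :
    coeff e j = 1 := by
  simp [coeff, h]

theorem coeff_of_ne_one {e : Activation m p} {j : Fin m ⊕ Fin p} (h : e.1 j ≠ 1) :
    coeff e j = 0 := by
  have h0 : e.1 j = 0 := by
    generalize e.1 j = t at h
    revert h; revert t; decide
  simp [coeff, h0]

theorem measurable_coeff (j : Fin m ⊕ Fin p) :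
    Measurable fun e : Activation m p => coeff e j := by
  have h : Measurable fun t : Fin 2 => ((t : ℕ) : ℝ) := measurable_of_finite _
  exact h.comp ((measurable_pi_apply j).comp measurable_subtype_coe)

theorem measurableSet_activation (j : Fin m ⊕ Fin p) :
    MeasurableSet {e : Activation m p | e.1 j = 1} :=
  measurableSet_eq_fun ((measurable_pi_apply j).comp measurable_subtype_coe) measurable_const

variable {Ω : Type*} [MeasurableSpace Ω] {P : Measure Ω} [IsProbabilityMeasure P]

/-- Almost surely, every coordinate is activated infinitely often. -/
theorem ae_frequently_activated {ε : ℕ → Ω → Activation m p} (hε : ∀ n, Measurable (ε n))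
    (hεid : ∀ n, IdentDistrib (ε n) (ε 0) P P)
    (hεindep : Pairwise fun n n' => IndepFun (ε n) (ε n') P) {j : Fin m ⊕ Fin p}
    (hpos : 0 < P {ω | (ε 0 ω).1 j = 1}) :
    ∀ᵐ ω ∂P, ∃ᶠ n in atTop, (ε n ω).1 j = 1 := by
  let X : ℕ → Ω → ℝ := fun n ω => coeff (ε n ω) j
  have hS : MeasurableSet {ω | (ε 0 ω).1 j = 1} := hε 0 (measurableSet_activation j)
  have hX0 : X 0 = Set.indicator {ω | (ε 0 ω).1 j = 1} 1 := by
    ext ω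
    by_cases h : (ε 0 ω).1 j = 1
    · simp [X, h, coeff_of_eq_one h]
    · simp [X, h, coeff_of_ne_one h]
  have hint : Integrable (X 0) P := by
    rw [hX0]
    exact (integrable_const (1 : ℝ)).indicator hS
  have hmean : 0 < ∫ ω, X 0 ω ∂P := by
    rw [hX0, integral_indicator_one hS]
    exact ENNReal.toReal_pos hpos.ne' (measure_ne_top _ _)
  -- This form of the strong law needs only pairwise independence. Finitely many activations would
  -- make the averages tend to 0 instead of the positive mean.
  have hlaw := strong_law_ae_real X hint
    (fun n n' hnn' => (hεindep hnn').comp (measurable_coeff j) (measurable_coeff j))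
    fun n => (hεid n).comp (measurable_coeff j)
  filter_upwards [hlaw] with ω hω
  by_contra hcon
  rw [not_frequently, eventually_atTop] at hcon
  obtain ⟨n₀, hn₀⟩ := hcon
  have hX : ∀ n, n ∉ Finset.range n₀ → X n ω = 0 := fun n hn =>
    coeff_of_ne_one (hn₀ n (by simpa using hn))
  have hsum : HasSum (fun n => X n ω) (∑ n ∈ Finset.range n₀, X n ω) :=
    hasSum_sum_of_ne_finset_zero hX
  have h0 := hsum.tendsto_sum_nat.div_atTop tendsto_natCast_atTop_atTop
  exact hmean.ne (tendsto_nhds_unique h0 hω)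

end Activation

/-! ### The filtration of the iterates. -/

theorem pastSigma_le {Ω A B : Type*} [mΩ : MeasurableSpace Ω] [MeasurableSpace A]
    [MeasurableSpace B] {x : ℕ → Ω → A} {y : ℕ → Ω → B} (hx : ∀ n, Measurable (x n))
    (hy : ∀ n, Measurable (y n)) (n : ℕ) : pastSigma x y n ≤ mΩ :=
  iSup₂_le fun j _ => ((hx j).prodMk (hy j)).comap_le

/-- The filtration generated by the iterates. -/
def pastFiltration {Ω A B : Type*} [mΩ : MeasurableSpace Ω] [MeasurableSpace A]
    [MeasurableSpace B] {x : ℕ → Ω → A} {y : ℕ → Ω → B} (hx : ∀ n, Measurable (x n))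
    (hy : ∀ n, Measurable (y n)) : Filtration ℕ mΩ where
  seq := pastSigma x y
  mono' _ _ h := biSup_mono fun _ hj => le_trans hj h
  le' := pastSigma_le hx hy

theorem measurable_pastFiltration {Ω A B : Type*} [mΩ : MeasurableSpace Ω] [MeasurableSpace A]
    [MeasurableSpace B] {x : ℕ → Ω → A} {y : ℕ → Ω → B} (hx : ∀ n, Measurable (x n))
    (hy : ∀ n, Measurable (y n)) (n : ℕ) :
    Measurable[pastFiltration hx hy n] fun ω => (x n ω, y n ω) :=
  Measurable.of_comap_le (le_iSup₂_of_le (f := fun j (_ : j ∈ Set.Iic n) =>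
    MeasurableSpace.comap (fun ω => (x j ω, y j ω)) inferInstance) n (Set.mem_Iic.2 le_rfl) le_rfl)

end BlockPrimalDual

/-! ### Assembly of the convergence theorem. -/

theorem mainTheorem12
    {m p : ℕ} {H : Fin m → Type*} {G : Fin p → Type*}
    [∀ i, NormedAddCommGroup (H i)] [∀ i, InnerProductSpace ℝ (H i)]
    [∀ i, CompleteSpace (H i)] [∀ i, TopologicalSpace.SeparableSpace (H i)]
    [∀ i, MeasurableSpace (H i)] [∀ i, BorelSpace (H i)]
    [∀ k, NormedAddCommGroup (G k)] [∀ k, InnerProductSpace ℝ (G k)]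
    [∀ k, CompleteSpace (G k)] [∀ k, TopologicalSpace.SeparableSpace (G k)]
    [∀ k, MeasurableSpace (G k)] [∀ k, BorelSpace (G k)]
    (f : ∀ i, H i → EReal) (hf : ∀ i, BlockPrimalDual.GammaZero (f i))
    (g : ∀ k, G k → EReal) (hg : ∀ k, BlockPrimalDual.GammaZero (g k))
    (L : ∀ k i, H i →L[ℝ] G k)
    -- `0 ∈ ∂f(x) + L^* ∂g(L x)` in the product space: the same `v ∈ ∂g(L x)` serves every `i`
    (hsol : ∃ (x : PiLp 2 H) (v : PiLp 2 G),
      (∀ k, v k ∈ BlockPrimalDual.subdiff (g k) (∑ j, L k j (x j))) ∧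
      ∀ i, ∃ u ∈ BlockPrimalDual.subdiff (f i) (x i),
        0 = u + ∑ k, ContinuousLinearMap.adjoint (L k i) (v k))
    (γ : ℝ) (hγ : 0 < γ)
    (μ : ℕ → ℝ) (hμ : ∀ n, μ n ∈ Set.Ioo (0 : ℝ) 2)
    (hμinf : 0 < ⨅ n, μ n) (hμsup : ⨆ n, μ n < 2)
    {Ω : Type*} [MeasurableSpace Ω] (P : Measure Ω) [IsProbabilityMeasure P]
    (x z a c : ℕ → Ω → PiLp 2 H) (y w b d : ℕ → Ω → PiLp 2 G)
    (hx0 : Measurable (x 0)) (hz0 : Measurable (z 0))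
    (hy0 : Measurable (y 0)) (hw0 : Measurable (w 0))
    (ha : ∀ n, Measurable (a n)) (hb : ∀ n, Measurable (b n))
    (hc : ∀ n, Measurable (c n)) (hd : ∀ n, Measurable (d n))
    (ε : ℕ → Ω → BlockPrimalDual.Activation m p) (hε : ∀ n, Measurable (ε n))
    (hεid : ∀ n, IdentDistrib (ε n) (ε 0) P P)
    (hεindep : Pairwise fun n n' => IndepFun (ε n) (ε n') P)
    -- the algorithm
    (hz : ∀ n ω i, z (n + 1) ω i = z n ω i + BlockPrimalDual.coeff (ε n ω) (Sum.inl i) •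
      ((BlockPrimalDual.projV L (x n ω) (y n ω)).fst i + c n ω i - z n ω i))
    (hx : ∀ n ω i, x (n + 1) ω i = x n ω i +
      (BlockPrimalDual.coeff (ε n ω) (Sum.inl i) * μ n) •
        (BlockPrimalDual.prox (fun t => (γ : EReal) * f i t)
            ((2 : ℝ) • z (n + 1) ω i - x n ω i) + a n ω i - z (n + 1) ω i))
    (hw : ∀ n ω k, w (n + 1) ω k = w n ω k + BlockPrimalDual.coeff (ε n ω) (Sum.inr k) •
      ((BlockPrimalDual.projV L (x n ω) (y n ω)).snd k + d n ω k - w n ω k))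
    (hy : ∀ n ω k, y (n + 1) ω k = y n ω k +
      (BlockPrimalDual.coeff (ε n ω) (Sum.inr k) * μ n) •
        (BlockPrimalDual.prox (fun t => (γ : EReal) * g k t)
            ((2 : ℝ) • w (n + 1) ω k - y n ω k) + b n ω k - w (n + 1) ω k))
    -- the errors
    (hasum : BlockPrimalDual.SummableErrors P (BlockPrimalDual.pastSigma x y) a)
    (hbsum : BlockPrimalDual.SummableErrors P (BlockPrimalDual.pastSigma x y) b)
    (hcsum : BlockPrimalDual.SummableErrors P (BlockPrimalDual.pastSigma x y) c)
    (hdsum : BlockPrimalDual.SummableErrors P (BlockPrimalDual.pastSigma x y) d)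
    (hcweak : ∀ᵐ ω ∂P, BlockPrimalDual.WeakTendsto (fun n => c n ω) 0)
    (hdweak : ∀ᵐ ω ∂P, BlockPrimalDual.WeakTendsto (fun n => d n ω) 0)
    -- the random sweeping
    (hindep : ∀ n, Indep (MeasurableSpace.comap (ε n) inferInstance)
      (BlockPrimalDual.pastSigma x y n) P)
    (hpos : ∀ j, 0 < P {ω | (ε 0 ω).1 j = 1}) :
    (∃ zlim : Ω → PiLp 2 H, Measurable zlim ∧
      (∀ ω, zlim ω ∈ BlockPrimalDual.primalSolutions f g L) ∧
      ∀ᵐ ω ∂P, BlockPrimalDual.WeakTendsto (fun n => z n ω) (zlim ω)) ∧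
    (∃ vlim : Ω → PiLp 2 G, Measurable vlim ∧
      (∀ ω, vlim ω ∈ BlockPrimalDual.dualSolutions f g L) ∧
      ∀ᵐ ω ∂P, BlockPrimalDual.WeakTendsto (fun n => γ⁻¹ • (w n ω - y n ω)) (vlim ω)) := by
  classical
  have hsecH : ∀ i, SecondCountableTopology (H i) := fun i =>
    UniformSpace.secondCountable_of_separable (H i)
  have hsecG : ∀ k, SecondCountableTopology (G k) := fun k =>
    UniformSpace.secondCountable_of_separable (G k)
  obtain ⟨x₀, v₀, hv₀, hu₀⟩ := hsol
  have hu₀' : ∀ i, -∑ k, ContinuousLinearMap.adjoint (L k i) (v₀ k) ∈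
      BlockPrimalDual.subdiff (f i) (x₀ i) := fun i => by
    obtain ⟨u, hu, h0⟩ := hu₀ i
    rwa [← eq_neg_of_add_eq_zero_left h0.symm]
  have hγf : ∀ i, BlockPrimalDual.GammaZero fun t => (γ : EReal) * f i t :=
    fun i => (hf i).const_mul hγ
  have hγg : ∀ k, BlockPrimalDual.GammaZero fun t => (γ : EReal) * g k t :=
    fun k => (hg k).const_mul hγ
  -- The given solution provides one subgradient for each scaled function, which is what existence
  -- of the proximal points relies on.
  have hfs : ∀ i, ∃ x u, u ∈ BlockPrimalDual.subdiff (fun t => (γ : EReal) * f i t) x := fun i =>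
    ⟨x₀ i, γ • -∑ k, ContinuousLinearMap.adjoint (L k i) (v₀ k), by
      rw [(hf i).mem_subdiff_const_mul_iff hγ, smul_smul, inv_mul_cancel₀ hγ.ne', one_smul]
      exact hu₀' i⟩
  have hgs : ∀ k, ∃ x u, u ∈ BlockPrimalDual.subdiff (fun t => (γ : EReal) * g k t) x := fun k =>
    ⟨∑ j, L k j (x₀ j), γ • v₀ k, by
      rw [(hg k).mem_subdiff_const_mul_iff hγ, smul_smul, inv_mul_cancel₀ hγ.ne', one_smul]
      exact hv₀ k⟩
  let V := BlockPrimalDual.graphSubspace L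
  let s : ℕ → Ω → BlockPrimalDual.BlockSpace H G := fun n ω => WithLp.toLp 2 (x n ω, y n ω)
  -- measurability of the iterates
  have hmeas : ∀ n, Measurable (x n) ∧ Measurable (y n) ∧ Measurable (z n) ∧ Measurable (w n) := by
    intro n
    induction n with
    | zero => exact ⟨hx0, hy0, hz0, hw0⟩
    | succ n ih =>
      obtain ⟨hxn, hyn, hzn, hwn⟩ := ih
      have hproj : Measurable fun ω => BlockPrimalDual.projV L (x n ω) (y n ω) :=
        V.starProjection.continuous.measurable.comp
          ((WithLp.measurable_toLp _ _).comp (hxn.prodMk hyn))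
      have hcoef : ∀ j, Measurable fun ω => BlockPrimalDual.coeff (ε n ω) j := fun j =>
        (BlockPrimalDual.measurable_coeff j).comp (hε n)
      have evH : ∀ i, Measurable fun q : PiLp 2 H => q i := fun i =>
        (PiLp.proj (𝕜 := ℝ) 2 H i).continuous.measurable
      have evG : ∀ k, Measurable fun q : PiLp 2 G => q k := fun k =>
        (PiLp.proj (𝕜 := ℝ) 2 G k).continuous.measurable
      have hz' : Measurable (z (n + 1)) := by
        refine (WithLp.measurable_toLp 2 _).comp (measurable_pi_iff.2 fun i => ?_)
        have e : (fun ω => (z (n + 1) ω).ofLp i) = _ := funext fun ω => hz n ω i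
        rw [e]
        exact ((evH i).comp hzn).add ((hcoef _).smul
          ((((evH i).comp ((WithLp.fstL 2 ℝ (PiLp 2 H) (PiLp 2 G)).continuous.measurable.comp
            hproj)).add ((evH i).comp (hc n))).sub ((evH i).comp hzn)))
      have hw' : Measurable (w (n + 1)) := by
        refine (WithLp.measurable_toLp 2 _).comp (measurable_pi_iff.2 fun k => ?_)
        have e : (fun ω => (w (n + 1) ω).ofLp k) = _ := funext fun ω => hw n ω k
        rw [e]
        exact ((evG k).comp hwn).add ((hcoef _).smul
          ((((evG k).comp ((WithLp.sndL 2 ℝ (PiLp 2 H) (PiLp 2 G)).continuous.measurable.comp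
            hproj)).add ((evG k).comp (hd n))).sub ((evG k).comp hwn)))
      refine ⟨?_, ?_, hz', hw'⟩
      · refine (WithLp.measurable_toLp 2 _).comp (measurable_pi_iff.2 fun i => ?_)
        have e : (fun ω => (x (n + 1) ω).ofLp i) = _ := funext fun ω => hx n ω i
        rw [e]
        exact ((evH i).comp hxn).add (((hcoef _).mul_const _).smul
          ((((((hγf i).continuous_prox (hfs i)).measurable.comp
            ((((evH i).comp hz').const_smul (2 : ℝ)).sub ((evH i).comp hxn)))).add
              ((evH i).comp (ha n))).sub ((evH i).comp hz')))
      · refine (WithLp.measurable_toLp 2 _).comp (measurable_pi_iff.2 fun k => ?_)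
        have e : (fun ω => (y (n + 1) ω).ofLp k) = _ := funext fun ω => hy n ω k
        rw [e]
        exact ((evG k).comp hyn).add (((hcoef _).mul_const _).smul
          ((((((hγg k).continuous_prox (hgs k)).measurable.comp
            ((((evG k).comp hw').const_smul (2 : ℝ)).sub ((evG k).comp hyn)))).add
              ((evG k).comp (hb n))).sub ((evG k).comp hw')))
  have hxm := fun n => (hmeas n).1
  have hym := fun n => (hmeas n).2.1
  have hzm := fun n => (hmeas n).2.2.1
  have hwm := fun n => (hmeas n).2.2.2
  let 𝓕 := BlockPrimalDual.pastFiltration hxm hym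
  -- The final 6 is the constant of `GammaZero.norm_step_error_le`.
  obtain ⟨ξ, hξm, hξ0, hEξ, hξs⟩ := BlockPrimalDual.exists_summable_error_bound (P := P) (𝓕 := 𝓕)
    ha hb hc hd hasum hbsum hcsum hdsum 6
  -- relaxation parameters
  have hbelow : BddBelow (Set.range μ) := ⟨0, by rintro _ ⟨n, rfl⟩; exact (hμ n).1.le⟩
  have habove : BddAbove (Set.range μ) := ⟨2, by rintro _ ⟨n, rfl⟩; exact (hμ n).2.le⟩
  have hlow : ∀ n, ⨅ n, μ n ≤ μ n := fun n => ciInf_le hbelow n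
  have hup : ∀ n, μ n ≤ ⨆ n, μ n := fun n => le_ciSup habove n
  -- activation probabilities
  let q : Fin m ⊕ Fin p → ℝ := fun j => (P {ω | (ε 0 ω).1 j = 1}).toReal
  have hprob : ∀ n j, P {ω | (ε n ω).1 j = 1} = ENNReal.ofReal (q j) := fun n j => by
    rw [ENNReal.ofReal_toReal (measure_ne_top _ _)]
    exact (hεid n).measure_mem_eq (BlockPrimalDual.measurableSet_activation j)
  -- errors in the block iteration
  let e : ℕ → Fin m ⊕ Fin p → Ω → BlockPrimalDual.BlockSpace H G := fun n j ω =>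
    Sum.elim
      (fun i => BlockPrimalDual.primalBlock H G i
        ((2 : ℝ) • (BlockPrimalDual.prox (fun t => (γ : EReal) * f i t)
            ((2 : ℝ) • ((V.starProjection (s n ω)).fst i + c n ω i) - x n ω i) -
          BlockPrimalDual.prox (fun t => (γ : EReal) * f i t) ((V.reflection (s n ω)).fst i)) +
          (2 : ℝ) • a n ω i - (2 : ℝ) • c n ω i))
      (fun k => BlockPrimalDual.dualBlock H G k
        ((2 : ℝ) • (BlockPrimalDual.prox (fun t => (γ : EReal) * g k t)
            ((2 : ℝ) • ((V.starProjection (s n ω)).snd k + d n ω k) - y n ω k) -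
          BlockPrimalDual.prox (fun t => (γ : EReal) * g k t) ((V.reflection (s n ω)).snd k)) +
          (2 : ℝ) • b n ω k - (2 : ℝ) • d n ω k)) j
  have hweak : ∀ᵐ ω ∂P, ∃ t, BlockPrimalDual.reflectedOperator f g L γ t = t ∧
      BlockPrimalDual.WeakTendsto (fun n => s n ω) t := by
    refine BlockPrimalDual.ae_exists_weakTendsto_fixed
      (Q := BlockPrimalDual.blockProj H G) BlockPrimalDual.sum_norm_blockProj_sq
      (BlockPrimalDual.norm_reflectedOperator_sub_le hγf hγg hfs hgs)
      (BlockPrimalDual.exists_fixed_of_kkt hγ hf hg hv₀ hu₀') (𝓕 := 𝓕)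
      (𝓖 := fun n => MeasurableSpace.comap (ε n) inferInstance) (fun n => (hε n).comap_le) hindep
      (B := fun n j => {ω | (ε n ω).1 j = 1})
      (fun n j => ⟨_, BlockPrimalDual.measurableSet_activation j, rfl⟩) (q := q)
      (fun j => ENNReal.toReal_pos (hpos j).ne' (measure_ne_top _ _))
      (fun j => ENNReal.toReal_le_of_le_ofReal zero_le_one (by simpa using prob_le_one)) hprob
      -- Bounding each factor of (μ_n/2)(1 - μ_n/2) separately gives κ; the two bounds on μ make it
      -- positive.
      (l := fun n => μ n / 2) (κ := (⨅ n, μ n) / 2 * (1 - (⨆ n, μ n) / 2))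
      (fun n => ⟨by linarith [(hμ n).1], by linarith [(hμ n).2]⟩)
      (mul_pos (by linarith) (by linarith))
      (fun n => mul_le_mul (by linarith [hlow n]) (by linarith [hup n]) (by linarith)
        (by linarith [(hμ n).1]))
      (fun n => (WithLp.measurable_toLp 2 _).comp
        (BlockPrimalDual.measurable_pastFiltration hxm hym n)) (e := e)
      (E := fun n ω => (6 : NNReal) * (‖a n ω‖ₑ + ‖b n ω‖ₑ + ‖c n ω‖ₑ + ‖d n ω‖ₑ))
      (fun n j ω => ?_) (fun n => ?_) hξm hξ0 hEξ hξs (fun n ω j hj => ?_) (fun n ω j hj => ?_)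
    · refine BlockPrimalDual.enorm_le_const_mul ?_
      push_cast
      cases j with
      | inl i =>
        simp only [e, Sum.elim_inl, BlockPrimalDual.norm_primalBlock,
          BlockPrimalDual.reflection_fst, V]
        refine ((hγf i).norm_step_error_le (hfs i) _ _ _ _).trans ?_
        have h1 := PiLp.norm_apply_le (a n ω) i
        have h2 := PiLp.norm_apply_le (c n ω) i
        linarith [norm_nonneg (b n ω), norm_nonneg (d n ω)]
      | inr k =>
        simp only [e, Sum.elim_inr, BlockPrimalDual.norm_dualBlock,
          BlockPrimalDual.reflection_snd, V]
        refine ((hγg k).norm_step_error_le (hgs k) _ _ _ _).trans ?_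
        have h1 := PiLp.norm_apply_le (b n ω) k
        have h2 := PiLp.norm_apply_le (d n ω) k
        linarith [norm_nonneg (a n ω), norm_nonneg (c n ω)]
    · exact ((((ha n).enorm.add (hb n).enorm).add (hc n).enorm).add (hd n).enorm).const_mul _
    · cases j with
      | inl i =>
        have hcf := BlockPrimalDual.coeff_of_eq_one hj
        have h1 := hz n ω i
        have h2 := hx n ω i
        rw [hcf] at h1 h2
        have h3 := BlockPrimalDual.active_step_eq (r₀ := BlockPrimalDual.prox
          (fun t => (γ : EReal) * f i t) ((V.reflection (s n ω)).fst i)) h1 h2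
        simp only [BlockPrimalDual.blockProj_inl, e, Sum.elim_inl]
        rw [← map_add, ← map_smul, ← map_add]
        refine congrArg _ (h3.trans ?_)
        have h4 := BlockPrimalDual.reflection_fst (L := L) (s n ω) i
        change _ = x n ω i + (μ n / 2) • (((2 : ℝ) • BlockPrimalDual.prox
          (fun t => (γ : EReal) * f i t) ((V.reflection (s n ω)).fst i) -
            (V.reflection (s n ω)).fst i) - x n ω i + _)
        simp only [V, h4]
        rfl
      | inr k =>
        have hcf := BlockPrimalDual.coeff_of_eq_one hj
        have h1 := hw n ω k
        have h2 := hy n ω k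
        rw [hcf] at h1 h2
        have h3 := BlockPrimalDual.active_step_eq (r₀ := BlockPrimalDual.prox
          (fun t => (γ : EReal) * g k t) ((V.reflection (s n ω)).snd k)) h1 h2
        simp only [BlockPrimalDual.blockProj_inr, e, Sum.elim_inr]
        rw [← map_add, ← map_smul, ← map_add]
        refine congrArg _ (h3.trans ?_)
        have h4 := BlockPrimalDual.reflection_snd (L := L) (s n ω) k
        change _ = y n ω k + (μ n / 2) • (((2 : ℝ) • BlockPrimalDual.prox
          (fun t => (γ : EReal) * g k t) ((V.reflection (s n ω)).snd k) -
            (V.reflection (s n ω)).snd k) - y n ω k + _)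
        simp only [V, h4]
        rfl
    · have hcf := BlockPrimalDual.coeff_of_ne_one hj
      cases j with
      | inl i =>
        have h2 := hx n ω i
        rw [hcf, zero_mul, zero_smul, add_zero] at h2
        exact congrArg (BlockPrimalDual.primalBlock H G i) h2
      | inr k =>
        have h2 := hy n ω k
        rw [hcf, zero_mul, zero_smul, add_zero] at h2
        exact congrArg (BlockPrimalDual.dualBlock H G k) h2
  have hfreq : ∀ᵐ ω ∂P, ∀ j, ∃ᶠ n in atTop, (ε n ω).1 j = 1 :=
    ae_all_iff.2 fun j => BlockPrimalDual.ae_frequently_activated hε hεid hεindep (hpos j)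
  have hfinal : ∀ᵐ ω ∂P, ∃ t, BlockPrimalDual.reflectedOperator f g L γ t = t ∧
      BlockPrimalDual.WeakTendsto (fun n => z n ω) (V.starProjection t).fst ∧
      BlockPrimalDual.WeakTendsto (fun n => γ⁻¹ • (w n ω - y n ω))
        (γ⁻¹ • ((V.starProjection t).snd - t.snd)) := by
    filter_upwards [hweak, hfreq, hcweak, hdweak] with ω ⟨t, ht, hst⟩ hfr hcω hdω
    have hPs := hst.map V.starProjection
    have hzω : BlockPrimalDual.WeakTendsto (fun n => z n ω) (V.starProjection t).fst := by
      refine BlockPrimalDual.weakTendsto_piLp fun i v => ?_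
      refine BlockPrimalDual.tendsto_of_frequently_refreshed
        (r := fun n => ⟪v, (V.starProjection (s n ω)).fst i + c n ω i⟫_ℝ) (hfr (Sum.inl i))
        (fun n hn => ?_) (fun n hn => ?_) ?_
      · rw [hz, BlockPrimalDual.coeff_of_eq_one hn, one_smul, add_sub_cancel]
        rfl
      · rw [hz, BlockPrimalDual.coeff_of_ne_one hn, zero_smul, add_zero]
      · have h1 := BlockPrimalDual.weakTendsto_iff_inner.1
          (hPs.map (PiLp.proj 2 H i ∘L WithLp.fstL 2 ℝ (PiLp 2 H) (PiLp 2 G))) v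
        have h2 := BlockPrimalDual.weakTendsto_iff_inner.1 (hcω.map (PiLp.proj (𝕜 := ℝ) 2 H i)) v
        have h3 := h1.add h2
        rw [map_zero, inner_zero_right, add_zero] at h3
        simp only [← inner_add_right] at h3
        exact h3
    have hwω : BlockPrimalDual.WeakTendsto (fun n => w n ω) (V.starProjection t).snd := by
      refine BlockPrimalDual.weakTendsto_piLp fun k v => ?_
      refine BlockPrimalDual.tendsto_of_frequently_refreshed
        (r := fun n => ⟪v, (V.starProjection (s n ω)).snd k + d n ω k⟫_ℝ) (hfr (Sum.inr k))
        (fun n hn => ?_) (fun n hn => ?_) ?_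
      · rw [hw, BlockPrimalDual.coeff_of_eq_one hn, one_smul, add_sub_cancel]
        rfl
      · rw [hw, BlockPrimalDual.coeff_of_ne_one hn, zero_smul, add_zero]
      · have h1 := BlockPrimalDual.weakTendsto_iff_inner.1
          (hPs.map (PiLp.proj 2 G k ∘L WithLp.sndL 2 ℝ (PiLp 2 H) (PiLp 2 G))) v
        have h2 := BlockPrimalDual.weakTendsto_iff_inner.1 (hdω.map (PiLp.proj (𝕜 := ℝ) 2 G k)) v
        have h3 := h1.add h2
        rw [map_zero, inner_zero_right, add_zero] at h3
        simp only [← inner_add_right] at h3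
        exact h3
    refine ⟨t, ht, hzω, BlockPrimalDual.weakTendsto_iff_inner.2 fun v => ?_⟩
    have h1 := BlockPrimalDual.weakTendsto_iff_inner.1 hwω v
    have h2 := BlockPrimalDual.weakTendsto_iff_inner.1
      (hst.map (WithLp.sndL 2 ℝ (PiLp 2 H) (PiLp 2 G))) v
    simp only [inner_smul_right, inner_sub_right]
    exact (h1.sub h2).const_mul _
  -- Nonemptiness of both solution sets supplies the values used on the exceptional null sets.
  obtain ⟨hp₀, hd₀⟩ := BlockPrimalDual.mem_solutions_of_kkt hf hg hv₀ hu₀'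
  constructor
  · refine BlockPrimalDual.exists_measurable_weak_limit hzm ⟨_, hp₀⟩ ?_
    filter_upwards [hfinal] with ω ⟨t, ht, h1, _⟩
    exact ⟨_, (BlockPrimalDual.mem_solutions_of_fixed hγ hf hg hfs hgs ht).1, h1⟩
  · refine BlockPrimalDual.exists_measurable_weak_limit
      (fun n => ((hwm n).sub (hym n)).const_smul γ⁻¹) ⟨_, hd₀⟩ ?_
    filter_upwards [hfinal] with ω ⟨t, ht, _, h2⟩
    exact ⟨_, (BlockPrimalDual.mem_solutions_of_fixed hγ hf hg hfs hgs ht).2, h2⟩
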